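/- Let $d\ge 1$, $T>0$, $L>0$, $\Omega=(0,L)^d$ and $Q_T=(0,T)\times\Omega$. Assume: (1) $J\in BV(\Omega\times\Omega)$ is symmetric and non-negative, $\int_{\Omega\times\Omega}J=1$, and $x\mapsto\int_\Omega J(x,y)\,dy$ belongs to $L^\infty(\Omega)$; (2) $A\in W^{1,\infty}_{\rm loc}(\mathbb R)$ (that is, $A$ is locally Lipschitz continuous), $A(-s)=-A(s)$ and $A(s)s\ge 0$ for all $s\in\mathbb R$; (3) $f:Q_T\times\mathbb R\to\mathbb R$ is such that $f(\cdot,\cdot,s)\in L^\infty(Q_T)\cap BV(Q_T)$ for every $s$, the map $s\mapsto f(\cdot,\cdot,s)$ is locally Lipschitz continuous in the $L^\infty$ norm and in total variation (for every $R$ there is $K$ such that, for almost every $(t,x)\in Q_T$, $|f(t,x,s)-f(t,x,s')|\le K|s-s'|$ for all $|s|,|s'|\le R$, and such that $|D(f(\cdot,\cdot,s)-f(\cdot,\cdot,s'))|(Q_T)\le K|s-s'|$ for all $|s|,|s'|\le R$), and $|f(\cdot,\cdot,s)|\le C_f(1+|s|)$ a.e. in $Q_T$ for all $s$, with a constant $C_f>0$;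 (4) $u_0\in L^\infty(\Omega)\cap BV(\Omega)$. Let $u\in W^{1,\infty}(0,T;L^\infty(\Omega))$ be the solution of $$\partial_t u(t,x)=\int_\Omega J(x,y)A(u(t,y)-u(t,x))\,dy+f(t,x,u(t,x))\quad\text{a.e. in }Q_T,\qquad u(0,\cdot)=u_0 \quad\text{a.e. in }\Omega.$$ For integers $N,m\ge 1$ put $\tau=T/N$, $t_n=n\tau$, $h=L/m$. For $\mathbf j\in\{1,\dots,m\}^d$ let $\Omega_{\mathbf j}$ be the open cube of side $h$ centered at $(\mathbf j-\tfrac12\mathbf 1)h$, and set $$J_h[\mathbf j,\mathbf k]=\frac1{h^{2d}}\int_{\Omega_{\mathbf j}}\int_{\Omega_{\mathbf k}}J(x,y)\,dy\,dx,\qquad f_{n\mathbf j}(s)=\frac1{\tau h^d}\int_{t_n}^{t_{n+1}}\int_{\Omega_{\mathbf j}}f(t,x,s)\,dx\,dt .$$ Define $u^0[\mathbf j]=h^{-d}\int_{\Omega_{\mathbf j}}u_0(x)\,dx$ and, for $n=0,\dots,N-1$, $$u^{n+1}[\mathbf j]=u^n[\mathbf j]+\tau\Big(h^d\sum_{\mathbf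 k}J_h[\mathbf j,\mathbf k]\,A(u^n[\mathbf k]-u^n[\mathbf j])+f_{n\mathbf j}(u^n[\mathbf j])\Big),$$ and let $u_{\tau h}(t,x)=u^n[\mathbf j]$ for $(t,x)\in[t_n,t_{n+1})\times\Omega_{\mathbf j}$. Then there is a constant $C$, depending only on $d$, $T$, $L$, $J$, $A$, $f$ and $u_0$, and in particular independent of $\tau$ and $h$, such that for all $N,m$ with $\tau<1$ and $h<1$ $$\|u-u_{\tau h}\|_{L^\infty(0,T;L^1(\Omega))}\le C(\tau+h).$$ -/

import Mathlib

open MeasureTheory Set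
open scoped ENNReal NNReal

noncomputable section

namespace NonlocalDiffusion

/-! ### Functions of bounded variation -/

section BV

variable {E : Type*} [NormedAddCommGroup E] [NormedSpace ℝ E] [MeasureSpace E]

/-- The divergence of a vector field `φ : E → E`. -/
def divergence (φ : E → E) (x : E) : ℝ :=
  LinearMap.trace ℝ E (fderiv ℝ φ x : E →ₗ[ℝ] E)

/-- Admissible test fields on `U`: of class `C¹`, compactly supported in `U`, bounded by `1`. -/
structure IsTestField (U : Set E) (φ : E → E) : Prop where
  contDiff : ContDiff ℝ 1 φ
  compact : HasCompactSupport φ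
  supp : tsupport φ ⊆ U
  bound : ∀ x, ‖φ x‖ ≤ 1

/-- The total variation `|Dv|(U) = sup { ∫_U v div φ : φ ∈ C¹_c(U; E), |φ| ≤ 1 }` of `v` in the
open set `U`. Below, `E` is a finite product of copies of `ℝ` with the maximum norm; the Euclidean
norm on the test fields gives the same value up to factors that depend on the dimension only. -/
def variation (U : Set E) (v : E → ℝ) : ℝ≥0∞ :=
  ⨆ (φ : E → E) (_ : IsTestField U φ), ENNReal.ofReal (∫ x in U, v x * divergence φ x)

/-- `v ∈ BV(U)`: `v ∈ L¹(U)` and `v` has finite total variation in `U`. -/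
def IsBV (U : Set E) (v : E → ℝ) : Prop :=
  IntegrableOn v U ∧ variation U v < ∞

end BV

/-! ### The continuous problem -/

/-- The open cube `Ω = (0, L)^d`. -/
def cube (d : ℕ) (L : ℝ) : Set (Fin d → ℝ) := {x | ∀ i, x i ∈ Ioo 0 L}

/-- The space-time cylinder `Q_T = (0, T) × Ω`. -/
def cylinder (d : ℕ) (T L : ℝ) : Set (ℝ × (Fin d → ℝ)) := Ioo 0 T ×ˢ cube d L

/-- The nonlocal operator `𝒜(v)(x) = ∫_Ω J(x, y) A(v(y) - v(x)) dy`. -/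
def nonlocalOp {d : ℕ} (L : ℝ) (J : (Fin d → ℝ) × (Fin d → ℝ) → ℝ) (A : ℝ → ℝ)
    (v : (Fin d → ℝ) → ℝ) (x : Fin d → ℝ) : ℝ :=
  ∫ y in cube d L, J (x, y) * A (v y - v x)

/-- Hypotheses on the spatial kernel. Only the values of `J` on `Ω × Ω` matter. -/
structure SpatialKernel {d : ℕ} (L : ℝ) (J : (Fin d → ℝ) × (Fin d → ℝ) → ℝ) : Prop where
  bv : IsBV (cube d L ×ˢ cube d L) J
  symm : ∀ᵐ p ∂(volume.restrict (cube d L ×ˢ cube d L)), J p.swap = J p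
  nonneg : ∀ᵐ p ∂(volume.restrict (cube d L ×ˢ cube d L)), 0 ≤ J p
  integral_eq_one : ∫ p in cube d L ×ˢ cube d L, J p = 1
  /-- `x ↦ ∫_Ω J(x, y) dy` is in `L^∞(Ω)`. -/
  marginal : ∃ K : ℝ≥0, ∀ᵐ x ∂(volume.restrict (cube d L)),
    ∫⁻ y in cube d L, ‖J (x, y)‖ₑ ≤ K

/-- Hypotheses on the range kernel: `A ∈ W^{1,∞}_loc(ℝ)` is odd and `A(s) s ≥ 0`. -/
structure RangeKernel (A : ℝ → ℝ) : Prop where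
  lipschitz : LocallyLipschitz A
  odd : ∀ s, A (-s) = -A s
  sign : ∀ s, 0 ≤ A s * s

/-- Hypotheses on the reaction function: `s ↦ f(·,·,s)` is locally Lipschitz continuous from `ℝ`
to `L^∞(Q_T) ∩ BV(Q_T)`, and `|f(·,·,s)| ≤ C_f (1 + |s|)`. -/
structure Reaction {d : ℕ} (T L : ℝ) (f : ℝ → (Fin d → ℝ) → ℝ → ℝ) : Prop where
  bounded : ∀ s, MemLp (fun z : ℝ × (Fin d → ℝ) => f z.1 z.2 s) ∞
    (volume.restrict (cylinder d T L))
  bv : ∀ s, IsBV (cylinder d T L) (fun z => f z.1 z.2 s)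
  lipschitz_sup : ∀ R : ℝ, ∃ K : ℝ, ∀ᵐ z ∂(volume.restrict (cylinder d T L)),
    ∀ s ∈ Icc (-R) R, ∀ s' ∈ Icc (-R) R, |f z.1 z.2 s - f z.1 z.2 s'| ≤ K * |s - s'|
  lipschitz_bv : ∀ R : ℝ, ∃ K : ℝ, ∀ s ∈ Icc (-R) R, ∀ s' ∈ Icc (-R) R,
    variation (cylinder d T L) (fun z => f z.1 z.2 s - f z.1 z.2 s') ≤
      ENNReal.ofReal (K * |s - s'|)
  growth : ∃ Cf : ℝ, 0 < Cf ∧ ∀ᵐ z ∂(volume.restrict (cylinder d T L)),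
    ∀ s, |f z.1 z.2 s| ≤ Cf * (1 + |s|)

/-- Hypotheses on the initial datum: `u₀ ∈ L^∞(Ω) ∩ BV(Ω)`. -/
structure InitialDatum {d : ℕ} (L : ℝ) (u₀ : (Fin d → ℝ) → ℝ) : Prop where
  bounded : MemLp u₀ ∞ (volume.restrict (cube d L))
  bv : IsBV (cube d L) u₀

/-- `u ∈ W^{1,∞}(0, T; L^∞(Ω))` solves
`∂ₜu = 𝒜(u) + f(t, x, u)` a.e. in `Q_T`, `u(0, ·) = u₀` a.e. in `Ω`.
(An element of `W^{1,∞}(0, T; L^∞(Ω))` is represented by a function which, for a.e. `x`, is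
Lipschitz continuous in `t`, with a constant independent of `x`. Its boundedness follows from that
of `u₀`.) -/
structure IsSolution {d : ℕ} (T L : ℝ) (J : (Fin d → ℝ) × (Fin d → ℝ) → ℝ) (A : ℝ → ℝ)
    (f : ℝ → (Fin d → ℝ) → ℝ → ℝ) (u₀ : (Fin d → ℝ) → ℝ)
    (u : ℝ → (Fin d → ℝ) → ℝ) : Prop where
  measurable : AEStronglyMeasurable (fun z : ℝ × (Fin d → ℝ) => u z.1 z.2)
    (volume.restrict (cylinder d T L))
  lipschitz : ∃ K : ℝ≥0, ∀ᵐ x ∂(volume.restrict (cube d L)),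
    LipschitzOnWith K (fun t => u t x) (Icc 0 T)
  equation : ∀ᵐ x ∂(volume.restrict (cube d L)), ∀ᵐ t ∂(volume.restrict (Ioo 0 T)),
    HasDerivAt (fun s => u s x) (nonlocalOp L J A (u t) x + f t x (u t x)) t
  initial : ∀ᵐ x ∂(volume.restrict (cube d L)), u 0 x = u₀ x

/-! ### The discrete scheme

The mesh has `m` cells in each direction, of side `h = L / m`, and there are `N` time steps of
length `τ = T / N`. The multi-indices `j` run over `{0, …, m - 1}^d`. -/

/-- The cell `Ω_j`: the open cube of side `h` centered at `(j + 1/2) h`. -/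
def cell {d m : ℕ} (h : ℝ) (j : Fin d → Fin m) : Set (Fin d → ℝ) :=
  {x | ∀ i, |x i - ((j i : ℝ) + 1 / 2) * h| < h / 2}

/-- The mean value `v_h[j]` of `v` in `Ω_j`. -/
def cellAverage {d m : ℕ} (h : ℝ) (v : (Fin d → ℝ) → ℝ) (j : Fin d → Fin m) : ℝ :=
  1 / h ^ d * ∫ x in cell h j, v x

/-- `J_h[j, k]`, the mean value of `J` in `Ω_j × Ω_k`. -/
def kernelAverage {d m : ℕ} (h : ℝ) (J : (Fin d → ℝ) × (Fin d → ℝ) → ℝ)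
    (j k : Fin d → Fin m) : ℝ :=
  1 / h ^ (2 * d) * ∫ x in cell h j, ∫ y in cell h k, J (x, y)

/-- `f_{nj}(s)`, the mean value of `f(·,·,s)` in `(t_n, t_{n+1}) × Ω_j`, with `t_n = n τ`. -/
def reactionAverage {d m : ℕ} (τ h : ℝ) (f : ℝ → (Fin d → ℝ) → ℝ → ℝ) (n : ℕ)
    (j : Fin d → Fin m) (s : ℝ) : ℝ :=
  1 / (τ * h ^ d) * ∫ t in (n * τ)..((n + 1) * τ), ∫ x in cell h j, f t x s

/-- The discrete operator `𝒜_h(v)[j] = h^d ∑_k J_h[j, k] A(v[k] - v[j])`. -/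
def discreteOp {d m : ℕ} (h : ℝ) (J : (Fin d → ℝ) × (Fin d → ℝ) → ℝ) (A : ℝ → ℝ)
    (v : (Fin d → Fin m) → ℝ) (j : Fin d → Fin m) : ℝ :=
  h ^ d * ∑ k, kernelAverage h J j k * A (v k - v j)

/-- The values `uⁿ[j]` of the explicit Euler scheme
`u⁰[j] = (u₀)_h[j]`, `uⁿ⁺¹[j] = uⁿ[j] + τ (𝒜_h(uⁿ)[j] + f_{nj}(uⁿ[j]))`. -/
def scheme {d m : ℕ} (τ h : ℝ) (J : (Fin d → ℝ) × (Fin d → ℝ) → ℝ) (A : ℝ → ℝ)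
    (f : ℝ → (Fin d → ℝ) → ℝ → ℝ) (u₀ : (Fin d → ℝ) → ℝ) : ℕ → (Fin d → Fin m) → ℝ
  | 0 => fun j => cellAverage h u₀ j
  | n + 1 => fun j =>
      scheme τ h J A f u₀ n j +
        τ * (discreteOp h J A (scheme τ h J A f u₀ n) j +
          reactionAverage τ h f n j (scheme τ h J A f u₀ n j))

open scoped Classical in
/-- The piecewise constant interpolator `u_{τh}`, with `τ = T / N` and `h = L / m`:
`u_{τh}(t, x) = uⁿ[j]` if `(t, x) ∈ [t_n, t_{n+1}) × Ω_j` with `n < N` (and `0` elsewhere). -/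
def discreteSolution {d : ℕ} (T L : ℝ) (J : (Fin d → ℝ) × (Fin d → ℝ) → ℝ) (A : ℝ → ℝ)
    (f : ℝ → (Fin d → ℝ) → ℝ → ℝ) (u₀ : (Fin d → ℝ) → ℝ) (N m : ℕ)
    (t : ℝ) (x : Fin d → ℝ) : ℝ :=
  ∑ n ∈ Finset.range N, ∑ j : Fin d → Fin m,
    if t ∈ Ico (n * (T / N)) ((n + 1) * (T / N)) ∧ x ∈ cell (L / m) j then
      scheme (T / N) (L / m) J A f u₀ n j
    else 0

/-- The norm of `w` in `L^∞(0, T; L¹(Ω))`. -/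
def normLinftyL1 {d : ℕ} (T L : ℝ) (w : ℝ → (Fin d → ℝ) → ℝ) : ℝ≥0∞ :=
  essSup (fun t => ∫⁻ x in cube d L, ‖w t x‖ₑ) (volume.restrict (Ioo 0 T))

end NonlocalDiffusion

end

/-! The error is measured through cell integrals. Let `E n` be the sum over the cells of `|∫ (u(t_n,
x) - uⁿ[j]) dx|`. The scheme is the cell average of the equation evaluated at the piecewise constant
function with values `uⁿ[j]`, so averaging `J` and `f` creates no consistency error
(`integrableOn_nonlocalOp_cellwise`, `Reaction.integral_cell_eq`). Local Lipschitz bounds and the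
bounded marginal of `J` then give `E (n + 1) ≤ E n + τ c (O(τ) + ‖u(t_n) - uⁿ‖₁)`
(`IsSolution.averageError_succ_le`), where the `O(τ)` comes from the Lipschitz continuity of `u` in
time.

The recursion closes because the full `L¹` error exceeds `E n` by at most `h^{-d} ∑_j ∫_{Ω_j}
∫_{Ω_j} |u(x) - u(x')|`, which is `O(h)` by `IsSolution.exists_oscillation_le`. To see this, the
equations at `x` and `x'` are subtracted and Gronwall's inequality is applied in time for fixed `x,
x'`. What remains are oscillations of `u₀`, `J` and `f`, controlled by the `L¹` modulus of
continuity of BV functions (`lintegral_translate_sub_le`). It is not necessary to show that `u(t)`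
is in BV.

The delicate term is `f(t, x, r) - f(t, x', r)` with `r = u(t, x')`, because the variation of `f` is
controlled only for frozen `r`. The range of values is divided into `m` equal intervals and `f` is
telescoped along the nodes (`abs_sub_le_sum_increments`). The increments have variation `O(1/m)`
each, hence bounded variation in total, and rounding `r` to a node costs `O(1/m) = O(h)`.

The local Lipschitz constants require uniform bounds on `u` and on `uⁿ`. The bound on `uⁿ` holds
without a restriction on the time step (`exists_abs_scheme_le`). Finally, two solutions are limits
of the same scheme, hence agree (`IsSolution.ae_eq`), so the constant found for one solution depends
only on the data. -/

noncomputable section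

namespace NonlocalDiffusion

/-! ### BV functions: translations in `L¹`. -/

section Translation

/-- The differential of `ψ z` has rank one, so its trace is a directional derivative. Fields of this
form are the only ones tested against the total variation. -/
theorem divergence_smul_const {E : Type*} [NormedAddCommGroup E] [NormedSpace ℝ E]
    [FiniteDimensional ℝ E] {ψ : E → ℝ} {x : E}
    (hψ : DifferentiableAt ℝ ψ x) (z : E) :
    divergence (fun y => ψ y • z) x = fderiv ℝ ψ x z := by
  unfold divergence
  have h : fderiv ℝ (fun y => ψ y • z) x = (fderiv ℝ ψ x).smulRight z :=
    (hψ.hasFDerivAt.smul_const z).fderiv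
  rw [h]
  have h2 : (((fderiv ℝ ψ x).smulRight z : E →L[ℝ] E) : E →ₗ[ℝ] E)
      = ((fderiv ℝ ψ x : E →L[ℝ] ℝ) : E →ₗ[ℝ] ℝ).smulRight z := rfl
  rw [h2]
  simp

variable {E : Type*} [NormedAddCommGroup E] [NormedSpace ℝ E] [MeasureSpace E]

/-- The distributional derivative in the direction `z` is bounded by the total variation. -/
theorem abs_integral_mul_fderiv_le [FiniteDimensional ℝ E] {U : Set E} {v : E → ℝ}
    (hv : variation U v < ∞) {ψ : E → ℝ} (hψ : ContDiff ℝ 1 ψ) (hc : HasCompactSupport ψ)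
    (hs : tsupport ψ ⊆ U) (hb : ∀ x, |ψ x| ≤ 1) (z : E) :
    |∫ x in U, v x * fderiv ℝ ψ x z| ≤ ‖z‖ * (variation U v).toReal := by
  have key : ∀ y : E, ‖y‖ ≤ 1 →
      ∫ x in U, v x * fderiv ℝ ψ x y ≤ (variation U v).toReal := by
    intro y hy
    have ht : IsTestField U (fun x => ψ x • y) := by
      refine ⟨hψ.smul contDiff_const, hc.smul_right, ?_, fun x => ?_⟩
      · exact (closure_mono (Function.support_smul_subset_left ψ _)).trans hs
      · rw [norm_smul]
        exact mul_le_one₀ (hb x) (norm_nonneg _) hy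
    have h1 : ENNReal.ofReal (∫ x in U, v x * divergence (fun x => ψ x • y) x) ≤ variation U v :=
      le_iSup₂_of_le _ ht le_rfl
    have h2 : ∀ x, divergence (fun x => ψ x • y) x = fderiv ℝ ψ x y := fun x =>
      divergence_smul_const (hψ.differentiable one_ne_zero x) y
    simp only [h2] at h1
    exact (ENNReal.ofReal_le_iff_le_toReal hv.ne).1 h1
  rcases eq_or_ne z 0 with rfl | hz
  · simp
  have hz' : 0 < ‖z‖ := norm_pos_iff.2 hz
  have key2 : ∀ c : ℝ, |c| = 1 →
      c * ∫ x in U, v x * fderiv ℝ ψ x z ≤ ‖z‖ * (variation U v).toReal := by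
    intro c hc
    have h := key ((c * ‖z‖⁻¹) • z) (by
      rw [norm_smul, Real.norm_eq_abs, abs_mul, hc, abs_inv, abs_norm, one_mul,
        inv_mul_cancel₀ hz'.ne'])
    have h3 : ∫ x in U, v x * fderiv ℝ ψ x ((c * ‖z‖⁻¹) • z)
        = (c * ‖z‖⁻¹) * ∫ x in U, v x * fderiv ℝ ψ x z := by
      rw [← integral_const_mul]
      congr 1
      ext x
      rw [map_smul, smul_eq_mul]
      ring
    rw [h3] at h
    calc c * ∫ x in U, v x * fderiv ℝ ψ x z
        = ‖z‖ * ((c * ‖z‖⁻¹) * ∫ x in U, v x * fderiv ℝ ψ x z) := by field_simp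
      _ ≤ _ := mul_le_mul_of_nonneg_left h hz'.le
  rw [abs_le']
  constructor
  · simpa using key2 1 (by simp)
  · simpa using key2 (-1) (by simp)

variable [BorelSpace E] [FiniteDimensional ℝ E] [(volume : Measure E).IsAddHaarMeasure]

/-- Testing a translation difference against a test function. -/
theorem abs_integral_mul_translate_sub_le {U : Set E} (hU : IsOpen U) (hconv : Convex ℝ U)
    {v : E → ℝ} (hv : IsBV U v) (z : E) {ψ : E → ℝ} (hψ : ContDiff ℝ 1 ψ)
    (hc : HasCompactSupport ψ) (hs : tsupport ψ ⊆ U ∩ (fun x => x + z) ⁻¹' U)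
    (hb : ∀ x, |ψ x| ≤ 1) :
    |∫ x in U ∩ (fun x => x + z) ⁻¹' U, ψ x * (v (x + z) - v x)|
      ≤ ‖z‖ * (variation U v).toReal := by
  -- Extension by zero turns the integrals into integrals over the whole space, where translation is
  -- measure preserving.
  set w : E → ℝ := U.indicator v with hw
  have hwi : Integrable w := hv.1.integrable_indicator hU.measurableSet
  have hcont : Continuous ψ := hψ.continuous
  have hdc : Continuous (fderiv ℝ ψ) := hψ.continuous_fderiv one_ne_zero
  obtain ⟨B, hB⟩ : ∃ B, ∀ x, ‖fderiv ℝ ψ x‖ ≤ B :=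
    hdc.bounded_above_of_compact_support (hc.fderiv ℝ)
  -- The translation is moved onto the smooth factor, which makes `F` differentiable. The tested
  -- difference is `F 1 - F 0`, and `F'` pairs `v` with a directional derivative of a test function.
  set F : ℝ → ℝ := fun s => ∫ x, ψ (x - s • z) * w x with hF
  set F' : ℝ → ℝ := fun s => ∫ x, -(fderiv ℝ ψ (x - s • z) z) * w x with hF'
  have hder : ∀ s, HasDerivAt F (F' s) s := by
    intro s
    refine (hasDerivAt_integral_of_dominated_loc_of_deriv_le (μ := volume) (s := Set.univ)
      (F := fun s x => ψ (x - s • z) * w x)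
      (F' := fun s x => -(fderiv ℝ ψ (x - s • z) z) * w x)
      (bound := fun x => (B * ‖z‖) * ‖w x‖) Filter.univ_mem ?_ ?_ ?_ ?_ ?_ ?_).2
    · refine Filter.Eventually.of_forall fun s => ?_
      exact (hcont.comp (by fun_prop)).aestronglyMeasurable.mul hwi.aestronglyMeasurable
    · refine hwi.bdd_mul (c := 1) (hcont.comp (by fun_prop)).aestronglyMeasurable ?_
      exact Filter.Eventually.of_forall fun x => hb _
    · refine AEStronglyMeasurable.mul ?_ hwi.aestronglyMeasurable
      have : Continuous fun x => -(fderiv ℝ ψ (x - s • z) z) := by fun_prop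
      exact this.aestronglyMeasurable
    · refine Filter.Eventually.of_forall fun x s _ => ?_
      rw [norm_mul, norm_neg]
      gcongr
      exact ((fderiv ℝ ψ (x - s • z)).le_opNorm z).trans (by gcongr; exact hB _)
    · exact hwi.norm.const_mul _
    · refine Filter.Eventually.of_forall fun x s _ => ?_
      have h1 : HasDerivAt (fun s : ℝ => x - s • z) (-z) s := by
        simpa using ((hasDerivAt_id s).smul_const z).const_sub x
      have h2 := ((hψ.differentiable one_ne_zero (x - s • z)).hasFDerivAt.comp_hasDerivAt s h1)
      simpa using h2.mul_const (w x)
  have hbd : ∀ s ∈ Icc (0 : ℝ) 1, ‖F' s‖ ≤ ‖z‖ * (variation U v).toReal := by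
    intro s hs01
    set φ : E → ℝ := fun x => ψ (x - s • z) with hφ
    have hts : tsupport φ ⊆ (fun x => x - s • z) ⁻¹' tsupport ψ :=
      tsupport_comp_subset_preimage ψ (by fun_prop)
    have hφs : tsupport φ ⊆ U := by
      intro x hx
      have h1 := hs (hts hx)
      -- If `x - s z` is in the support of `ψ`, then it and `x - s z + z` lie in `U`, and `x` is a
      -- convex combination of the two.
      have h2 := hconv h1.1 h1.2 (a := 1 - s) (b := s) (by linarith [hs01.2]) hs01.1 (by ring)
      have h3 : (1 - s) • (x - s • z) + s • (x - s • z + z) = x := by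
        module
      change (1 - s) • (x - s • z) + s • (x - s • z + z) ∈ U at h2
      rwa [h3] at h2
    have hφc : HasCompactSupport φ :=
      hc.comp_homeomorph (Homeomorph.subRight (s • z))
    have hφd : ContDiff ℝ 1 φ := hψ.comp (by fun_prop)
    have h := abs_integral_mul_fderiv_le hv.2 hφd hφc hφs (fun x => hb _) z
    have h4 : F' s = -∫ x in U, v x * fderiv ℝ φ x z := by
      rw [hF', ← integral_neg, ← integral_indicator hU.measurableSet]
      refine integral_congr_ae (Filter.Eventually.of_forall fun x => ?_)
      dsimp only
      have h5 : fderiv ℝ φ x = fderiv ℝ ψ (x - s • z) := fderiv_comp_sub (s • z)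
      by_cases hx : x ∈ U
      · simp only [hw, indicator_of_mem hx, h5]; ring
      · simp [hw, indicator_of_notMem hx]
    rw [h4, norm_neg]
    exact h
  have hmv := norm_image_sub_le_of_norm_deriv_le_segment_01' (f := F) (f' := F')
    (fun s _ => (hder s).hasDerivWithinAt) (fun s hs => hbd s ⟨hs.1, hs.2.le⟩)
  have hfin : ∫ x in U ∩ (fun x => x + z) ⁻¹' U, ψ x * (v (x + z) - v x) = F 1 - F 0 := by
    have hm : MeasurableSet (U ∩ (fun x => x + z) ⁻¹' U) :=
      (hU.inter (hU.preimage (by fun_prop))).measurableSet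
    rw [← integral_indicator hm]
    have e1 : F 1 = ∫ x, ψ x * w (x + z) := by
      calc F 1 = ∫ x, ψ (x + z - (1 : ℝ) • z) * w (x + z) :=
            (integral_add_right_eq_self (fun x => ψ (x - (1 : ℝ) • z) * w x) z).symm
        _ = _ := by simp
    have e0 : F 0 = ∫ x, ψ x * w x := by simp [hF]
    rw [e1, e0, ← integral_sub]
    · refine integral_congr_ae (Filter.Eventually.of_forall fun x => ?_)
      dsimp only
      by_cases hx : x ∈ U ∩ (fun x => x + z) ⁻¹' U
      · have hx2 : x + z ∈ U := hx.2
        rw [indicator_of_mem hx, hw, indicator_of_mem hx.1, indicator_of_mem hx2]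
        ring
      · rw [indicator_of_notMem hx, image_eq_zero_of_notMem_tsupport (fun h => hx (hs h))]
        ring
    · exact (hwi.comp_add_right z).bdd_mul (c := 1) hcont.aestronglyMeasurable
        (Filter.Eventually.of_forall fun x => hb _)
    · exact hwi.bdd_mul (c := 1) hcont.aestronglyMeasurable
        (Filter.Eventually.of_forall fun x => hb _)
  rw [hfin]
  exact hmv

omit [(volume : Measure E).IsAddHaarMeasure] in
/-- The `L¹` norm of `w` on an open set is tested by smooth compactly supported functions. -/
theorem lintegral_enorm_le_of_forall_integral_mul_le {W : Set E} (hW : IsOpen W) {w : E → ℝ}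
    (hw : IntegrableOn w W) {C : ℝ}
    (h : ∀ ψ : E → ℝ, ContDiff ℝ 1 ψ → HasCompactSupport ψ → tsupport ψ ⊆ W →
      (∀ x, |ψ x| ≤ 1) → ∫ x in W, ψ x * w x ≤ C) :
    ∫⁻ x in W, ‖w x‖ₑ ≤ ENNReal.ofReal C := by
  -- the estimate on pairs of disjoint compact sets
  have hK : ∀ K K' : Set E, IsCompact K → IsCompact K' → K ⊆ W → K' ⊆ W → Disjoint K K' →
      (∫ x in K, w x) - ∫ x in K', w x ≤ C := by
    intro K K' hK hK' hKW hKW' hd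
    obtain ⟨δ₀, hδ₀, hdisj⟩ := hd.exists_thickenings hK hK'.isClosed
    obtain ⟨δ₁, hδ₁, hc1⟩ := hK.exists_cthickening_subset_open hW hKW
    obtain ⟨δ₂, hδ₂, hc2⟩ := hK'.exists_cthickening_subset_open hW hKW'
    set δ := min δ₀ (min δ₁ δ₂) with hδ
    have hδpos : 0 < δ := lt_min hδ₀ (lt_min hδ₁ hδ₂)
    obtain ⟨r, -, hr, hrlim⟩ : ∃ r : ℕ → ℝ, StrictAnti r ∧ (∀ n, r n ∈ Ioo 0 δ) ∧
      Filter.Tendsto r Filter.atTop (nhds 0) := exists_seq_strictAnti_tendsto' hδpos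
    have hex : ∀ S : Set E, IsCompact S → ∀ n, ∃ g : E → ℝ, ContDiff ℝ 1 g ∧
        range g ⊆ Icc 0 1 ∧ Function.support g = Metric.thickening (r n) S ∧
        ∀ x ∈ S, g x = 1 := by
      intro S hS n
      obtain ⟨g, g1, g2, g3, g4⟩ := exists_contMDiff_support_eq_eq_one_iff
        (n := 1) (modelWithCornersSelf ℝ E) (Metric.isOpen_thickening (δ := r n) (E := S))
        hS.isClosed (Metric.self_subset_thickening (hr n).1 S)
      exact ⟨g, g1.contDiff, g2, g3, fun x hx => (g4 x).1 hx⟩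
    choose g g_diff g_range g_supp g_one using hex K hK
    choose g' g_diff' g_range' g_supp' g_one' using hex K' hK'
    have hlim : ∀ (S : Set E) (g : ℕ → E → ℝ), IsCompact S → S ⊆ W → (∀ n, ContDiff ℝ 1 (g n)) →
        (∀ n, range (g n) ⊆ Icc 0 1) →
        (∀ n, Function.support (g n) = Metric.thickening (r n) S) →
        (∀ n, ∀ x ∈ S, g n x = 1) →
        Filter.Tendsto (fun n => ∫ x in W, g n x * w x) Filter.atTop (nhds (∫ x in S, w x)) := by
      intro S g hS hSW hd hrange hsupp hone
      have e : ∫ x in S, w x = ∫ x in W, S.indicator w x := by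
        rw [setIntegral_indicator hS.measurableSet, inter_eq_self_of_subset_right hSW]
      rw [e]
      refine tendsto_integral_of_dominated_convergence (fun x => ‖w x‖)
        (fun n => (hd n).continuous.aestronglyMeasurable.mul hw.aestronglyMeasurable)
        hw.norm (fun n => Filter.Eventually.of_forall fun x => ?_)
        (Filter.Eventually.of_forall fun x => ?_)
      · have := hrange n (mem_range_self x)
        rw [norm_mul, Real.norm_of_nonneg this.1]
        exact mul_le_of_le_one_left (norm_nonneg _) this.2
      · by_cases hx : x ∈ S
        · simp [hone _ x hx, hx]
        · rw [indicator_of_notMem hx]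
          refine tendsto_const_nhds.congr' ?_
          obtain ⟨ε, hε, hεx⟩ : ∃ ε, 0 < ε ∧ x ∉ Metric.thickening ε S := by
            rw [← hS.isClosed.closure_eq, Metric.closure_eq_iInter_thickening S] at hx
            simpa using hx
          filter_upwards [(tendsto_order.1 hrlim).2 _ hε] with n hn
          have : g n x = 0 := by
            rw [← Function.notMem_support, hsupp]
            exact fun hx' => hεx (Metric.thickening_mono hn.le S hx')
          simp [this]
    have hl := (hlim K g hK hKW g_diff g_range g_supp g_one).sub
      (hlim K' g' hK' hKW' g_diff' g_range' g_supp' g_one')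
    refine le_of_tendsto' hl fun n => ?_
    have hts : ∀ (S : Set E) (g : E → ℝ), IsCompact S →
        Function.support g = Metric.thickening (r n) S →
        HasCompactSupport g ∧ tsupport g ⊆ Metric.cthickening (r n) S := by
      intro S g hS hg
      have : tsupport g ⊆ Metric.cthickening (r n) S := by
        rw [tsupport, hg]
        exact Metric.closure_thickening_subset_cthickening _ _
      exact ⟨hS.cthickening.of_isClosed_subset (isClosed_tsupport g) this, this⟩
    obtain ⟨c1, s1⟩ := hts K (g n) hK (g_supp n)
    obtain ⟨c2, s2⟩ := hts K' (g' n) hK' (g_supp' n)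
    have hrn := (hr n).2.le
    have hint : ∀ g : E → ℝ, ContDiff ℝ 1 g → range g ⊆ Icc 0 1 →
        Integrable (fun x => g x * w x) (volume.restrict W) := by
      intro g hg hgr
      refine Integrable.bdd_mul hw (c := 1) hg.continuous.aestronglyMeasurable
        (Filter.Eventually.of_forall fun x => ?_)
      have := hgr (mem_range_self x)
      rw [Real.norm_of_nonneg this.1]
      exact this.2
    rw [← integral_sub (hint _ (g_diff n) (g_range n)) (hint _ (g_diff' n) (g_range' n))]
    -- Both bumps take values in `[0, 1]`, so their difference is an admissible test function. It
    -- approximates the indicator of `K` minus that of `K'`.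
    have := h (fun x => g n x - g' n x) ((g_diff n).sub (g_diff' n)) (c1.sub c2)
      ((tsupport_sub _ _).trans (union_subset
        ((s1.trans (Metric.cthickening_mono (hrn.trans ((min_le_right _ _).trans
          (min_le_left _ _))) K)).trans hc1)
        ((s2.trans (Metric.cthickening_mono (hrn.trans ((min_le_right _ _).trans
          (min_le_right _ _))) K')).trans hc2)))
      (fun x => by
        have h1 := g_range n (mem_range_self x)
        have h2 := g_range' n (mem_range_self x)
        rw [abs_le]
        constructor <;> linarith [h1.1, h1.2, h2.1, h2.2])
    simpa only [sub_mul] using this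
  -- approximate the positivity and negativity sets from inside
  obtain ⟨w', hw'm, hww'⟩ : ∃ w' : E → ℝ, StronglyMeasurable w' ∧ w =ᵐ[volume.restrict W] w' :=
    ⟨hw.aestronglyMeasurable.mk w, hw.aestronglyMeasurable.stronglyMeasurable_mk,
      hw.aestronglyMeasurable.ae_eq_mk⟩
  have hw' : IntegrableOn w' W := hw.congr hww'
  set P : Set E := W ∩ {x | 0 ≤ w' x} with hP
  set N : Set E := W ∩ {x | w' x < 0} with hN
  have hPm : MeasurableSet P :=
    hW.measurableSet.inter (measurableSet_le measurable_const hw'm.measurable)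
  have hNm : MeasurableSet N :=
    hW.measurableSet.inter (measurableSet_lt hw'm.measurable measurable_const)
  have hPN : Disjoint P N := by
    rw [Set.disjoint_left]
    rintro x ⟨-, hx⟩ ⟨-, hx'⟩
    exact absurd (show 0 ≤ w' x from hx) (not_le.2 (show w' x < 0 from hx'))
  have hWPN : W = P ∪ N := by
    ext x
    simp only [hP, hN, mem_union, mem_inter_iff, mem_ofPred_eq]
    constructor
    · intro hx
      rcases le_or_gt 0 (w' x) with h | h
      · exact Or.inl ⟨hx, h⟩
      · exact Or.inr ⟨hx, h⟩
    · rintro (hx | hx) <;> exact hx.1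
  -- The finite measure `|w'| dx` is inner regular, so compact subsets of the two sign sets carry
  -- all of the `L¹` norm up to `ε`.
  set ν : Measure E := (volume.restrict W).withDensity (fun x => ‖w' x‖ₑ) with hν
  have hνfin : IsFiniteMeasure ν :=
    isFiniteMeasure_withDensity (by simpa [HasFiniteIntegral] using hw'.hasFiniteIntegral.ne)
  have hνS : ∀ S : Set E, MeasurableSet S → S ⊆ W → ν S = ∫⁻ x in S, ‖w' x‖ₑ := by
    intro S hS hSW
    rw [hν, withDensity_apply _ hS, Measure.restrict_restrict hS,
      inter_eq_self_of_subset_left hSW]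
  refine ENNReal.le_of_forall_pos_le_add fun ε hε _ => ?_
  have hε2 : (ε / 2 : ℝ≥0∞) ≠ 0 := by
    simp [hε.ne']
  obtain ⟨K, hKP, hKc, hKlt⟩ := hPm.exists_isCompact_lt_add (measure_ne_top ν P) hε2
  obtain ⟨K', hKN, hKc', hKlt'⟩ := hNm.exists_isCompact_lt_add (measure_ne_top ν N) hε2
  have hKW : K ⊆ W := hKP.trans inter_subset_left
  have hKW' : K' ⊆ W := hKN.trans inter_subset_left
  have e1 : ν K = ENNReal.ofReal (∫ x in K, w x) := by
    rw [hνS K hKc.measurableSet hKW,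
      integral_congr_ae (ae_restrict_of_ae_restrict_of_subset hKW hww'),
      ofReal_integral_eq_lintegral_ofReal (hw'.mono_set hKW)
        ((ae_restrict_iff' hKc.measurableSet).2 (Filter.Eventually.of_forall
          fun x hx => (hKP hx).2))]
    refine setLIntegral_congr_fun hKc.measurableSet fun x hx => ?_
    exact Real.enorm_of_nonneg (hKP hx).2
  have e2 : ν K' = ENNReal.ofReal (-∫ x in K', w x) := by
    rw [hνS K' hKc'.measurableSet hKW',
      integral_congr_ae (ae_restrict_of_ae_restrict_of_subset hKW' hww'), ← integral_neg,
      ofReal_integral_eq_lintegral_ofReal (f := fun x => -w' x) (hw'.mono_set hKW').neg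
        ((ae_restrict_iff' hKc'.measurableSet).2 (Filter.Eventually.of_forall
          fun x hx => by simpa using (hKN hx).2.le))]
    refine setLIntegral_congr_fun hKc'.measurableSet fun x hx => ?_
    rw [← enorm_neg]
    exact Real.enorm_of_nonneg (by simpa using (hKN hx).2.le)
  have p1 : 0 ≤ ∫ x in K, w x := by
    rw [integral_congr_ae (ae_restrict_of_ae_restrict_of_subset hKW hww')]
    exact setIntegral_nonneg hKc.measurableSet fun x hx => (hKP hx).2
  have p2 : 0 ≤ -∫ x in K', w x := by
    rw [integral_congr_ae (ae_restrict_of_ae_restrict_of_subset hKW' hww'), ← integral_neg]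
    exact setIntegral_nonneg hKc'.measurableSet fun x hx => by simpa using (hKN hx).2.le
  calc ∫⁻ x in W, ‖w x‖ₑ = ∫⁻ x in W, ‖w' x‖ₑ :=
        lintegral_congr_ae (hww'.fun_comp enorm)
    _ = ν P + ν N := by
        rw [hνS P hPm inter_subset_left, hνS N hNm inter_subset_left, ← lintegral_union hNm hPN,
          ← hWPN]
    _ ≤ (ν K + ε / 2) + (ν K' + ε / 2) := add_le_add hKlt.le hKlt'.le
    _ = ENNReal.ofReal ((∫ x in K, w x) - ∫ x in K', w x) + ε := by
        rw [e1, e2, sub_eq_add_neg, ENNReal.ofReal_add p1 p2, add_add_add_comm,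
          ENNReal.add_halves]
    _ ≤ ENNReal.ofReal C + ε := by
        gcongr
        exact hK K K' hKc hKc' hKW hKW' (hPN.mono hKP hKN)

/-- The `L¹` modulus of continuity of a function of bounded variation on a convex open set. -/
theorem lintegral_translate_sub_le {U : Set E} (hU : IsOpen U) (hconv : Convex ℝ U)
    {v : E → ℝ} (hv : IsBV U v) (z : E) :
    ∫⁻ x in U ∩ (fun x => x + z) ⁻¹' U, ‖v (x + z) - v x‖ₑ ≤ ‖z‖ₑ * variation U v := by
  have hint : IntegrableOn (fun x => v (x + z) - v x) (U ∩ (fun x => x + z) ⁻¹' U) := by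
    refine Integrable.sub ?_ (hv.1.mono_set inter_subset_left)
    have := ((measurePreserving_add_right (volume : Measure E) z).integrableOn_comp_preimage
      (MeasurableEquiv.addRight z).measurableEmbedding (s := U) (f := v)).2 hv.1
    exact IntegrableOn.mono_set this inter_subset_right
  refine (lintegral_enorm_le_of_forall_integral_mul_le
    (hU.inter (hU.preimage (by fun_prop))) hint (C := ‖z‖ * (variation U v).toReal)
    fun ψ h1 h2 h3 h4 => (le_abs_self _).trans
      (abs_integral_mul_translate_sub_le hU hconv hv z h1 h2 h3 h4)).trans ?_
  rw [ENNReal.ofReal_mul (norm_nonneg _), ENNReal.ofReal_toReal hv.2.ne, ofReal_norm]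

end Translation

/-! ### Geometry of the mesh, and oscillation within cells. -/

section Cells

variable {d m : ℕ} {h : ℝ}

theorem cell_eq_pi (j : Fin d → Fin m) :
    cell h j = Set.pi univ fun i => Ioo ((j i : ℝ) * h) (((j i : ℝ) + 1) * h) := by
  ext x
  simp only [cell, mem_ofPred_eq, mem_pi, mem_univ, true_imp_iff, mem_Ioo]
  refine forall_congr' fun i => ?_
  rw [abs_lt]
  constructor <;> rintro ⟨h1, h2⟩ <;> constructor <;> linarith

theorem cube_eq_pi (d : ℕ) (L : ℝ) : cube d L = Set.pi univ fun _ => Ioo 0 L := by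
  ext x
  simp [cube]

theorem measurableSet_cell (j : Fin d → Fin m) : MeasurableSet (cell h j) := by
  rw [cell_eq_pi]
  exact MeasurableSet.univ_pi fun _ => measurableSet_Ioo

theorem isOpen_cube (d : ℕ) (L : ℝ) : IsOpen (cube d L) := by
  rw [cube_eq_pi]
  exact isOpen_set_pi finite_univ fun _ _ => isOpen_Ioo

theorem measurableSet_cube (d : ℕ) (L : ℝ) : MeasurableSet (cube d L) :=
  (isOpen_cube d L).measurableSet

theorem convex_cube (d : ℕ) (L : ℝ) : Convex ℝ (cube d L) := by
  rw [cube_eq_pi]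
  exact convex_pi fun _ _ => convex_Ioo _ _

theorem volume_cell (j : Fin d → Fin m) : volume (cell h j) = ENNReal.ofReal h ^ d := by
  rw [cell_eq_pi, Real.volume_pi_Ioo]
  simp [add_mul]

theorem volume_cube (d : ℕ) (L : ℝ) : volume (cube d L) = ENNReal.ofReal L ^ d := by
  rw [cube_eq_pi, Real.volume_pi_Ioo]
  simp

instance isFiniteMeasure_restrict_cube (d : ℕ) (L : ℝ) :
    IsFiniteMeasure (volume.restrict (cube d L)) :=
  ⟨by rw [Measure.restrict_apply_univ, volume_cube]; exact ENNReal.pow_lt_top ENNReal.ofReal_lt_top⟩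

theorem cell_subset_cube (hh : 0 < h) (j : Fin d → Fin m) : cell h j ⊆ cube d (m * h) := by
  intro x hx i
  rw [cell_eq_pi] at hx
  have hxi := hx i (mem_univ i)
  have h1 : (j i : ℝ) + 1 ≤ m := by exact_mod_cast (j i).2
  exact ⟨lt_of_le_of_lt (by positivity) hxi.1, hxi.2.trans_le (by gcongr)⟩

theorem eq_of_mem_cell (hh : 0 < h) {j k : Fin d → Fin m} {x : Fin d → ℝ} (hj : x ∈ cell h j)
    (hk : x ∈ cell h k) : j = k := by
  rw [cell_eq_pi] at hj hk
  funext i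
  have h1 := hj i (mem_univ i)
  have h2 := hk i (mem_univ i)
  have a1 : (j i : ℝ) < (k i : ℝ) + 1 := lt_of_mul_lt_mul_right (h1.1.trans h2.2) hh.le
  have a2 : (k i : ℝ) < (j i : ℝ) + 1 := lt_of_mul_lt_mul_right (h2.1.trans h1.2) hh.le
  have b1 : (j i : ℕ) < (k i : ℕ) + 1 := by exact_mod_cast a1
  have b2 : (k i : ℕ) < (j i : ℕ) + 1 := by exact_mod_cast a2
  exact Fin.ext (by omega)

theorem pairwise_disjoint_cell (hh : 0 < h) :
    Pairwise (Function.onFun Disjoint (cell h : (Fin d → Fin m) → Set (Fin d → ℝ))) :=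
  fun _ _ hjk => Set.disjoint_left.2 fun _ hx hx' => hjk (eq_of_mem_cell hh hx hx')

/-- The open cells omit their faces. That nothing of positive measure is lost follows from the
volume count `m^d h^d = (m h)^d`. -/
theorem iUnion_cell_ae_eq_cube (hh : 0 < h) :
    (⋃ j : Fin d → Fin m, cell h j) =ᵐ[volume] cube d (m * h) := by
  refine ae_eq_of_subset_of_measure_ge (iUnion_subset fun j => cell_subset_cube hh j) ?_
    (MeasurableSet.iUnion fun j => measurableSet_cell j).nullMeasurableSet ?_
  · rw [measure_iUnion (pairwise_disjoint_cell hh) fun j => measurableSet_cell j, tsum_fintype]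
    simp only [volume_cell, volume_cube, Finset.sum_const, Finset.card_univ, Fintype.card_fun,
      Fintype.card_fin, nsmul_eq_mul]
    rw [ENNReal.ofReal_mul (by positivity), mul_pow]
    simp
  · rw [volume_cube]
    exact (ENNReal.pow_lt_top ENNReal.ofReal_lt_top).ne

theorem lintegral_cube_eq_sum (hh : 0 < h) (F : (Fin d → ℝ) → ℝ≥0∞) :
    ∫⁻ x in cube d (m * h), F x = ∑ j : Fin d → Fin m, ∫⁻ x in cell h j, F x := by
  rw [← setLIntegral_congr (iUnion_cell_ae_eq_cube hh),
    lintegral_iUnion (fun j => measurableSet_cell j) (pairwise_disjoint_cell hh), tsum_fintype]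

theorem ae_cube_iff_forall_cell (hh : 0 < h) {p : (Fin d → ℝ) → Prop} :
    (∀ᵐ x ∂(volume.restrict (cube d (m * h))), p x) ↔
      ∀ j : Fin d → Fin m, ∀ᵐ x ∂(volume.restrict (cell h j)), p x := by
  rw [← Measure.restrict_congr_set (iUnion_cell_ae_eq_cube hh), ae_restrict_iUnion_iff]

theorem integral_cube_eq_sum (hh : 0 < h) {F : (Fin d → ℝ) → ℝ}
    (hF : IntegrableOn F (cube d (m * h))) :
    ∫ x in cube d (m * h), F x = ∑ j : Fin d → Fin m, ∫ x in cell h j, F x := by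
  rw [← setIntegral_congr_set (iUnion_cell_ae_eq_cube hh),
    integral_iUnion (fun j => measurableSet_cell j) (pairwise_disjoint_cell hh), tsum_fintype]
  exact hF.congr_set_ae (iUnion_cell_ae_eq_cube hh)

theorem norm_lt_of_mem_cell (hh : 0 < h) {j : Fin d → Fin m} {x z : Fin d → ℝ}
    (hx : x ∈ cell h j) (hz : x + z ∈ cell h j) : ‖z‖ < h := by
  rw [pi_norm_lt_iff hh]
  intro i
  rw [cell_eq_pi] at hx hz
  have h1 := hx i (mem_univ i)
  have h2 := hz i (mem_univ i)
  simp only [Pi.add_apply, mem_Ioo] at h1 h2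
  rw [Real.norm_eq_abs, abs_lt]
  constructor <;> linarith [h1.1, h1.2, h2.1, h2.2]

/-- The oscillation within cells is controlled by the `L¹` modulus of continuity. -/
theorem sum_lintegral_oscillation_le {Y : Type*} [MeasurableSpace Y] {ν : Measure Y} [SFinite ν]
    (hh : 0 < h) {g : Y × (Fin d → ℝ) → ℝ} (hg : Measurable g) {V : ℝ≥0∞}
    (hV : ∀ z : Fin d → ℝ,
      ∫⁻ y, (∫⁻ x in cube d (m * h) ∩ (fun x => x + z) ⁻¹' cube d (m * h),
        ‖g (y, x + z) - g (y, x)‖ₑ) ∂ν ≤ ‖z‖ₑ * V) :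
    ∑ j : Fin d → Fin m, ∫⁻ x in cell h j, ∫⁻ x' in cell h j,
        ∫⁻ y, ‖g (y, x) - g (y, x')‖ₑ ∂ν ≤
      ENNReal.ofReal h * V * ENNReal.ofReal (2 * h) ^ d := by
  set Ω := cube d (m * h) with hΩ
  set G : (Fin d → ℝ) → (Fin d → ℝ) → ℝ≥0∞ :=
    fun x z => ∫⁻ y, ‖g (y, x + z) - g (y, x)‖ₑ ∂ν with hG
  have hm3 : Measurable fun q : ((Fin d → ℝ) × (Fin d → ℝ)) × Y =>
      ‖g (q.2, q.1.1 + q.1.2) - g (q.2, q.1.1)‖ₑ := by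
    fun_prop
  have hGm : Measurable fun p : (Fin d → ℝ) × (Fin d → ℝ) => G p.1 p.2 := hm3.lintegral_prod_right'
  set D : (Fin d → ℝ) → Set (Fin d → ℝ) := fun z => Ω ∩ (fun x => x + z) ⁻¹' Ω with hD
  have hΩm : MeasurableSet Ω := measurableSet_cube _ _
  have hDm : ∀ z, MeasurableSet (D z) := fun z => hΩm.inter (hΩm.preimage (by fun_prop))
  set B : Set (Fin d → ℝ) := Metric.ball 0 h with hB
  -- With `x' = x + z`, two points of one cell satisfy `‖z‖ < h` in the maximum norm. Hence the sum
  -- over the cells is dominated by the integral of `H`, and by Fubini the modulus of continuity is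
  -- integrated over a ball of volume `(2h)^d`. The variable `y` is a parameter that is not
  -- translated.
  set H : (Fin d → ℝ) → (Fin d → ℝ) → ℝ≥0∞ :=
    fun x z => B.indicator 1 z * ((D z).indicator 1 x * G x z) with hH
  have hHm : Measurable fun p : (Fin d → ℝ) × (Fin d → ℝ) => H p.1 p.2 := by
    have e : (fun p : (Fin d → ℝ) × (Fin d → ℝ) => H p.1 p.2) = fun p =>
        (B.indicator 1 p.2 : ℝ≥0∞) *
          ((Ω.indicator 1 p.1 : ℝ≥0∞) * (Ω.indicator 1 (p.1 + p.2) : ℝ≥0∞) * G p.1 p.2) := by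
      funext p
      simp only [hH, hD, inter_indicator_one, Pi.mul_apply]
      rfl
    rw [e]
    have hB1 : Measurable (B.indicator (1 : (Fin d → ℝ) → ℝ≥0∞)) :=
      measurable_one.indicator measurableSet_ball
    have hΩ1 : Measurable (Ω.indicator (1 : (Fin d → ℝ) → ℝ≥0∞)) := measurable_one.indicator hΩm
    exact (hB1.comp measurable_snd).mul (((hΩ1.comp measurable_fst).mul
      (hΩ1.comp (measurable_fst.add measurable_snd))).mul hGm)
  calc ∑ j : Fin d → Fin m, ∫⁻ x in cell h j, ∫⁻ x' in cell h j,
        ∫⁻ y, ‖g (y, x) - g (y, x')‖ₑ ∂ν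
      ≤ ∑ j : Fin d → Fin m, ∫⁻ x in cell h j, ∫⁻ z, H x z := by
        refine Finset.sum_le_sum fun j _ => setLIntegral_mono' (measurableSet_cell j) fun x hx => ?_
        rw [← lintegral_indicator (measurableSet_cell j), ← lintegral_add_left_eq_self _ x]
        refine lintegral_mono fun z => ?_
        by_cases hz : x + z ∈ cell h j
        · rw [indicator_of_mem hz]
          have hzB : z ∈ B := by
            simpa [hB] using norm_lt_of_mem_cell hh hx hz
          have hxD : x ∈ D z := ⟨cell_subset_cube hh j hx, cell_subset_cube hh j hz⟩
          simp only [hH, indicator_of_mem hzB, indicator_of_mem hxD, Pi.one_apply, one_mul, hG]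
          refine lintegral_mono fun y => ?_
          rw [enorm_sub_rev]
        · rw [indicator_of_notMem hz]
          exact zero_le
    _ = ∫⁻ x in Ω, ∫⁻ z, H x z := (lintegral_cube_eq_sum hh _).symm
    _ ≤ ∫⁻ x, ∫⁻ z, H x z := setLIntegral_le_lintegral _ _
    _ = ∫⁻ z, ∫⁻ x, H x z := lintegral_lintegral_swap hHm.aemeasurable
    _ ≤ ∫⁻ z, B.indicator (fun _ => ENNReal.ofReal h * V) z := by
        refine lintegral_mono fun z => ?_
        by_cases hz : z ∈ B
        · simp only [hH, indicator_of_mem hz, Pi.one_apply, one_mul]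
          have e : ∀ x, (D z).indicator 1 x * G x z = (D z).indicator (fun x => G x z) x := by
            intro x
            by_cases hx : x ∈ D z <;> simp [hx]
          simp only [e]
          rw [lintegral_indicator (hDm z), hG, lintegral_lintegral_swap]
          · refine (hV z).trans ?_
            gcongr
            rw [← ofReal_norm]
            exact ENNReal.ofReal_le_ofReal (by simpa [hB] using (mem_ball_zero_iff.1 hz).le)
          · have : Measurable fun q : (Fin d → ℝ) × Y => ‖g (q.2, q.1 + z) - g (q.2, q.1)‖ₑ := by
              fun_prop
            exact this.aemeasurable
        · simp [hH, hz]
    _ = ENNReal.ofReal h * V * ENNReal.ofReal (2 * h) ^ d := by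
        rw [lintegral_indicator measurableSet_ball, setLIntegral_const, Real.volume_pi_ball _ hh]
        simp [ENNReal.ofReal_pow, hh.le]

end Cells

/-! ### Cell oscillation of BV functions. -/

section BVOscillation

theorem variation_congr {E : Type*} [NormedAddCommGroup E] [NormedSpace ℝ E] [MeasureSpace E]
    {U : Set E} {v w : E → ℝ} (hvw : v =ᵐ[volume.restrict U] w) : variation U v = variation U w := by
  unfold variation
  refine iSup_congr fun φ => iSup_congr fun _ => ?_
  congr 1
  exact integral_congr_ae (hvw.mono fun x hx => by simp only [hx])

theorem IsBV.congr {E : Type*} [NormedAddCommGroup E] [NormedSpace ℝ E] [MeasureSpace E]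
    {U : Set E} {v w : E → ℝ} (hv : IsBV U v) (hvw : v =ᵐ[volume.restrict U] w) : IsBV U w :=
  ⟨hv.1.congr hvw, variation_congr hvw ▸ hv.2⟩

variable {d m : ℕ} {h : ℝ}

/-- The sum of the product Lebesgue measures on `Ω_j × Ω_j`. -/
def cellPairMeasure (d m : ℕ) (h : ℝ) : Measure ((Fin d → ℝ) × (Fin d → ℝ)) :=
  ∑ j : Fin d → Fin m, (volume.restrict (cell h j)).prod (volume.restrict (cell h j))

theorem lintegral_cellPairMeasure {O : (Fin d → ℝ) × (Fin d → ℝ) → ℝ≥0∞} (hO : Measurable O) :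
    ∫⁻ p, O p ∂(cellPairMeasure d m h) =
      ∑ j : Fin d → Fin m, ∫⁻ x in cell h j, ∫⁻ x' in cell h j, O (x, x') := by
  rw [cellPairMeasure, lintegral_finsetSum_measure]
  exact Finset.sum_congr rfl fun j _ => lintegral_prod _ hO.aemeasurable

theorem cellPairMeasure_univ : cellPairMeasure d m h univ =
    (m * ENNReal.ofReal h) ^ d * ENNReal.ofReal h ^ d := by
  have := lintegral_cellPairMeasure (d := d) (m := m) (h := h) (O := fun _ => 1) measurable_const
  rw [lintegral_one] at this
  rw [this]
  simp only [lintegral_one, Measure.restrict_apply_univ, volume_cell, lintegral_const,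
    Finset.sum_const, Finset.card_univ, Fintype.card_fun, Fintype.card_fin, nsmul_eq_mul, mul_pow]
  push_cast
  ring

/-- Translations by `(0, z)` fix the `Y` factor, so the modulus of continuity on `Y × Ω` controls
the oscillation in the second variable alone. `O` is built from a measurable representative of `v`.
It is therefore measurable, and it does not depend on the mesh. -/
theorem IsBV.exists_oscillation_prod {F : Type*} [NormedAddCommGroup F] [NormedSpace ℝ F]
    [FiniteDimensional ℝ F] [MeasureSpace F] [BorelSpace F] [SecondCountableTopology F]
    [(volume : Measure F).IsAddHaarMeasure] {L : ℝ} {Y : Set F} (hY : IsOpen Y)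
    (hYc : Convex ℝ Y) {v : F × (Fin d → ℝ) → ℝ} (hv : IsBV (Y ×ˢ cube d L) v) :
    ∃ O : (Fin d → ℝ) × (Fin d → ℝ) → ℝ≥0∞, Measurable O ∧
      (∀ᵐ x ∂(volume.restrict (cube d L)), ∀ᵐ x' ∂(volume.restrict (cube d L)),
        ∫⁻ y in Y, ‖v (y, x) - v (y, x')‖ₑ = O (x, x')) ∧
      ∀ (m : ℕ) (h : ℝ), 0 < h → m * h = L → ∫⁻ p, O p ∂(cellPairMeasure d m h) ≤
        ENNReal.ofReal h * variation (Y ×ˢ cube d L) v * ENNReal.ofReal (2 * h) ^ d := by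
  have hUo : IsOpen (Y ×ˢ cube d L) := hY.prod (isOpen_cube _ _)
  have hUc : Convex ℝ (Y ×ˢ cube d L) := hYc.prod (convex_cube _ _)
  set g : F × (Fin d → ℝ) → ℝ := hv.1.aestronglyMeasurable.mk v with hg
  have hgm : Measurable g := hv.1.aestronglyMeasurable.stronglyMeasurable_mk.measurable
  have hvg : v =ᵐ[volume.restrict (Y ×ˢ cube d L)] g := hv.1.aestronglyMeasurable.ae_eq_mk
  have hgbv := hv.congr hvg
  have hae : ∀ᵐ x ∂(volume.restrict (cube d L)), ∀ᵐ y ∂(volume.restrict Y),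
      v (y, x) = g (y, x) := by
    have h1 : ∀ᵐ p ∂((volume.restrict Y).prod (volume.restrict (cube d L))), v p = g p := by
      rw [Measure.prod_restrict]
      exact hvg
    exact Measure.ae_ae_of_ae_prod
      (Measure.measurePreserving_swap.quasiMeasurePreserving.ae h1)
  have hm : Measurable fun q : ((Fin d → ℝ) × (Fin d → ℝ)) × F =>
      ‖g (q.2, q.1.1) - g (q.2, q.1.2)‖ₑ := by fun_prop
  have hOm : Measurable fun p : (Fin d → ℝ) × (Fin d → ℝ) =>
      ∫⁻ y in Y, ‖g (y, p.1) - g (y, p.2)‖ₑ := hm.lintegral_prod_right'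
  refine ⟨_, hOm, ?_, ?_⟩
  · filter_upwards [hae] with x hx
    filter_upwards [hae] with x' hx'
    refine lintegral_congr_ae ?_
    filter_upwards [hx, hx'] with y h1 h2
    rw [h1, h2]
  · rintro m h hh rfl
    rw [lintegral_cellPairMeasure hOm, variation_congr hvg]
    refine sum_lintegral_oscillation_le hh hgm fun z => ?_
    have hHaar : (volume : Measure (F × (Fin d → ℝ))).IsAddHaarMeasure := by
      rw [Measure.volume_eq_prod]
      infer_instance
    have hz : ‖((0 : F), z)‖ₑ = ‖z‖ₑ := by
      rw [← ofReal_norm, Prod.norm_def]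
      simp
    have h1 := lintegral_translate_sub_le hUo hUc hgbv ((0 : F), z)
    have e : (Y ×ˢ cube d (m * h)) ∩ (fun x => x + ((0 : F), z)) ⁻¹' (Y ×ˢ cube d (m * h))
        = Y ×ˢ (cube d (m * h) ∩ (fun x => x + z) ⁻¹' cube d (m * h)) := by
      ext ⟨y, x⟩
      simp only [mem_inter_iff, mem_prod, mem_preimage, Prod.mk_add_mk, add_zero]
      tauto
    rw [e, Measure.volume_eq_prod, ← Measure.prod_restrict, lintegral_prod] at h1
    · simpa [hz] using h1
    · have : Measurable fun x => ‖g (x + ((0 : F), z)) - g x‖ₑ := by fun_prop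
      exact this.aemeasurable

theorem IsBV.exists_oscillation {L : ℝ} {v : (Fin d → ℝ) → ℝ} (hv : IsBV (cube d L) v) :
    ∃ O : (Fin d → ℝ) × (Fin d → ℝ) → ℝ≥0∞, Measurable O ∧
      (∀ᵐ x ∂(volume.restrict (cube d L)), ∀ᵐ x' ∂(volume.restrict (cube d L)),
        ‖v x - v x'‖ₑ = O (x, x')) ∧
      ∀ (m : ℕ) (h : ℝ), 0 < h → m * h = L → ∫⁻ p, O p ∂(cellPairMeasure d m h) ≤
        ENNReal.ofReal h * variation (cube d L) v * ENNReal.ofReal (2 * h) ^ d := by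
  set g : (Fin d → ℝ) → ℝ := hv.1.aestronglyMeasurable.mk v with hg
  have hgm : Measurable g := hv.1.aestronglyMeasurable.stronglyMeasurable_mk.measurable
  have hvg : v =ᵐ[volume.restrict (cube d L)] g := hv.1.aestronglyMeasurable.ae_eq_mk
  have hOm : Measurable fun p : (Fin d → ℝ) × (Fin d → ℝ) => ‖g p.1 - g p.2‖ₑ := by fun_prop
  refine ⟨_, hOm, ?_, ?_⟩
  · filter_upwards [hvg] with x hx
    filter_upwards [hvg] with x' hx'
    rw [hx, hx']
  · rintro m h hh rfl
    rw [lintegral_cellPairMeasure hOm, variation_congr hvg]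
    -- Without a parameter variable, the parameter space is a single point.
    have := sum_lintegral_oscillation_le (ν := Measure.dirac ()) (m := m)
      (g := fun p : Unit × (Fin d → ℝ) => g p.2) hh (hgm.comp measurable_snd)
      (V := variation (cube d (m * h)) g) fun z => by
        simpa using lintegral_translate_sub_le (isOpen_cube _ _) (convex_cube _ _)
          (hv.congr hvg) z
    simpa using this

end BVOscillation

/-! ### Gronwall inequalities in continuous time. -/

section Gronwall

/-- Gronwall's inequality in integral form. -/
theorem le_mul_exp_of_le_add_mul_integral {g : ℝ → ℝ} {T G c : ℝ}
    (hg : ContinuousOn g (Icc 0 T)) (hg0 : ∀ t ∈ Icc 0 T, 0 ≤ g t) (hc : 0 < c)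
    (h : ∀ t ∈ Icc 0 T, g t ≤ G + c * ∫ s in (0 : ℝ)..t, g s) :
    ∀ t ∈ Icc 0 T, g t ≤ G * Real.exp (c * t) := by
  intro t ht
  have hT : 0 ≤ T := ht.1.trans ht.2
  -- A continuous extension to the whole line makes the primitive differentiable everywhere, also at
  -- the endpoints.
  set e : ℝ → ℝ := IccExtend hT (fun x : Icc 0 T => g x) with he
  have hec : Continuous e := (continuousOn_iff_continuous_domRestrict.1 hg).Icc_extend'
  have heg : ∀ s ∈ Icc 0 T, e s = g s := fun s hs => by
    rw [he, IccExtend_of_mem hT (fun x : Icc 0 T => g x) hs]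
  have hint : ∀ s ∈ Icc 0 T, ∫ r in (0 : ℝ)..s, g r = ∫ r in (0 : ℝ)..s, e r := by
    intro s hs
    refine intervalIntegral.integral_congr fun r hr => ?_
    rw [uIcc_of_le hs.1] at hr
    exact (heg r ⟨hr.1, hr.2.trans hs.2⟩).symm
  have hH : ∀ s ∈ Icc 0 T, 0 ≤ ∫ r in (0 : ℝ)..s, e r := by
    intro s hs
    refine intervalIntegral.integral_nonneg hs.1 fun r hr => ?_
    rw [heg r ⟨hr.1, hr.2.trans hs.2⟩]
    exact hg0 r ⟨hr.1, hr.2.trans hs.2⟩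
  have hd : ∀ s, HasDerivAt (fun s => ∫ r in (0 : ℝ)..s, e r) (e s) s := fun s =>
    intervalIntegral.integral_hasDerivAt_right (hec.intervalIntegrable _ _)
      (hec.stronglyMeasurableAtFilter _ _) hec.continuousAt
  -- The primitive `H` vanishes at `0` and satisfies `H' ≤ c H + G`. Its bound is then inserted in
  -- the hypothesis on `g`.
  have hb := norm_le_gronwallBound_of_norm_deriv_right_le
    (f := fun s => ∫ r in (0 : ℝ)..s, e r) (f' := e) (δ := 0) (K := c) (ε := G) (a := 0) (b := T)
    (fun s _ => (hd s).continuousAt.continuousWithinAt) (fun s _ => (hd s).hasDerivWithinAt)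
    (by simp) (fun s hs => by
      have hs' : s ∈ Icc 0 T := ⟨hs.1, hs.2.le⟩
      rw [Real.norm_of_nonneg (hH s hs'), Real.norm_of_nonneg (by rw [heg s hs']; exact hg0 s hs'),
        heg s hs', ← hint s hs', add_comm]
      exact h s hs') t ht
  rw [Real.norm_of_nonneg (hH t ht), gronwallBound_of_K_ne_0 hc.ne'] at hb
  simp only [zero_mul, zero_add, sub_zero] at hb
  refine (h t ht).trans ?_
  rw [hint t ht]
  calc G + c * ∫ r in (0 : ℝ)..t, e r ≤ G + c * (G / c * (Real.exp (c * t) - 1)) := by gcongr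
    _ = G * Real.exp (c * t) := by field_simp; ring

/-- Lipschitz functions are absolutely continuous, so the fundamental theorem of calculus applies to
`deriv p`, which equals `p'` almost everywhere. Integrability of `p'` is part of the conclusion: for
the solution, no measurability in time of the right-hand side is assumed. -/
theorem intervalIntegrable_and_integral_eq_sub {p p' : ℝ → ℝ} {T a b : ℝ} {K : ℝ≥0}
    (hp : LipschitzOnWith K p (Icc 0 T))
    (hd : ∀ᵐ s ∂(volume.restrict (Ioo 0 T)), HasDerivAt p (p' s) s)
    (ha : 0 ≤ a) (hab : a ≤ b) (hb : b ≤ T) :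
    IntervalIntegrable p' volume a b ∧ ∫ s in a..b, p' s = p b - p a := by
  have hac : AbsolutelyContinuousOnInterval p a b := by
    refine LipschitzOnWith.absolutelyContinuousOnInterval (K := K) (hp.mono ?_)
    rw [uIcc_of_le hab]
    exact Icc_subset_Icc ha hb
  have hcongr : deriv p =ᵐ[volume.restrict (Ioc a b)] p' := by
    have h1 : ∀ᵐ s ∂(volume.restrict (Ioo a b)), HasDerivAt p (p' s) s :=
      ae_restrict_of_ae_restrict_of_subset (Ioo_subset_Ioo ha hb) hd
    rw [restrict_Ioo_eq_restrict_Ioc] at h1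
    exact h1.mono fun s hs => hs.deriv
  constructor
  · refine hac.intervalIntegrable_deriv.congr_ae ?_
    rwa [uIoc_of_le hab]
  · rw [← hac.integral_deriv_eq_sub]
    refine (intervalIntegral.integral_congr_ae ?_).symm
    rw [uIoc_of_le hab]
    exact (ae_restrict_iff' measurableSet_Ioc).1 hcongr

/-- Gronwall's inequality for a Lipschitz function with a differential inequality a.e. -/
theorem enorm_le_exp_mul_of_ae_deriv_le {p p' : ℝ → ℝ} {T c : ℝ} {K : ℝ≥0} (hc : 0 < c)
    (hp : LipschitzOnWith K p (Icc 0 T))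
    (hd : ∀ᵐ s ∂(volume.restrict (Ioo 0 T)), HasDerivAt p (p' s) s) {b : ℝ → ℝ≥0∞}
    (hb : ∀ᵐ s ∂(volume.restrict (Ioo 0 T)), ‖p' s‖ₑ ≤ ENNReal.ofReal c * ‖p s‖ₑ + b s)
    {t : ℝ} (ht : t ∈ Icc 0 T) :
    ‖p t‖ₑ ≤ ENNReal.ofReal (Real.exp (c * T)) * (‖p 0‖ₑ + ∫⁻ s in Ioo 0 T, b s) := by
  have hT : 0 ≤ T := ht.1.trans ht.2
  rcases eq_or_ne (∫⁻ s in Ioo 0 T, b s) ∞ with hinf | hfin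
  · rw [hinf, add_top, ENNReal.mul_top]
    · exact le_top
    · simpa using Real.exp_pos (c * T)
  set B : ℝ := (∫⁻ s in Ioo 0 T, b s).toReal with hB
  have hBe : ∫⁻ s in Ioo 0 T, b s = ENNReal.ofReal B := (ENNReal.ofReal_toReal hfin).symm
  have hcont : ContinuousOn p (Icc 0 T) := hp.continuousOn
  have hkey : ∀ t ∈ Icc 0 T, |p t| ≤ (|p 0| + B) + c * ∫ s in (0 : ℝ)..t, |p s| := by
    intro t ht
    have hsub : Ioo 0 t ⊆ Ioo 0 T := Ioo_subset_Ioo le_rfl ht.2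
    have hF := (intervalIntegrable_and_integral_eq_sub hp hd le_rfl ht.1 ht.2).2
    have hci : IntervalIntegrable (fun s => |p s|) volume 0 t := by
      refine ContinuousOn.intervalIntegrable ?_
      rw [uIcc_of_le ht.1]
      exact (hcont.mono (Icc_subset_Icc le_rfl ht.2)).abs
    have hm : AEMeasurable (fun s => ENNReal.ofReal c * ‖p s‖ₑ) (volume.restrict (Ioo 0 t)) := by
      have : AEMeasurable p (volume.restrict (Ioo 0 t)) :=
        (hcont.mono (Ioo_subset_Icc_self.trans (Icc_subset_Icc le_rfl ht.2))).aemeasurable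
          measurableSet_Ioo
      fun_prop
    have h1 : ‖p t - p 0‖ₑ ≤ ENNReal.ofReal (c * ∫ s in (0 : ℝ)..t, |p s|) + ENNReal.ofReal B := by
      rw [← hF, intervalIntegral.integral_of_le ht.1, ← restrict_Ioo_eq_restrict_Ioc]
      refine (enorm_integral_le_lintegral_enorm _).trans ?_
      refine (lintegral_mono_ae (ae_restrict_of_ae_restrict_of_subset hsub hb)).trans ?_
      rw [lintegral_add_left' hm]
      refine add_le_add ?_ ?_
      · rw [lintegral_const_mul' _ _ ENNReal.ofReal_ne_top, ENNReal.ofReal_mul hc.le,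
          intervalIntegral.integral_of_le ht.1, ← restrict_Ioo_eq_restrict_Ioc,
          ofReal_integral_eq_lintegral_ofReal]
        · gcongr with s
          rw [← ofReal_norm, Real.norm_eq_abs]
        · rw [restrict_Ioo_eq_restrict_Ioc]
          exact hci.1
        · exact Filter.Eventually.of_forall fun s => abs_nonneg _
      · rw [← hBe]
        exact lintegral_mono_set hsub
    have hI : 0 ≤ ∫ s in (0 : ℝ)..t, |p s| :=
      intervalIntegral.integral_nonneg ht.1 fun s _ => abs_nonneg _
    have hB0 : 0 ≤ B := ENNReal.toReal_nonneg
    rw [← ENNReal.ofReal_add (by positivity) hB0, ← ofReal_norm,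
      ENNReal.ofReal_le_ofReal_iff (by positivity), Real.norm_eq_abs] at h1
    have h2 : |p t| ≤ |p 0| + |p t - p 0| := by
      have := abs_add_le (p 0) (p t - p 0)
      simpa using this
    linarith
  have h3 := le_mul_exp_of_le_add_mul_integral (g := fun t => |p t|) hcont.abs
    (fun t _ => abs_nonneg _) hc hkey t ht
  have hB0 : 0 ≤ B := ENNReal.toReal_nonneg
  rw [hBe, ← ofReal_norm, ← ofReal_norm, ← ENNReal.ofReal_add (norm_nonneg _) hB0,
    ← ENNReal.ofReal_mul (Real.exp_pos _).le]
  refine ENNReal.ofReal_le_ofReal (h3.trans ?_)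
  rw [mul_comm, Real.norm_eq_abs]
  have : Real.exp (c * t) ≤ Real.exp (c * T) :=
    Real.exp_le_exp.2 (mul_le_mul_of_nonneg_left ht.2 hc.le)
  gcongr

end Gronwall

/-! ### Pointwise estimates for the reaction and the nonlocal term. -/

section Pointwise

/-- The difference of two Lipschitz functions at an arbitrary point is controlled by the
differences of their increments along a uniform partition. -/
theorem abs_sub_le_sum_increments {F₁ F₂ : ℝ → ℝ} {K R : ℝ} (hR : 0 < R)
    (h₁ : ∀ s ∈ Icc (-R) R, ∀ s' ∈ Icc (-R) R, |F₁ s - F₁ s'| ≤ K * |s - s'|)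
    (h₂ : ∀ s ∈ Icc (-R) R, ∀ s' ∈ Icc (-R) R, |F₂ s - F₂ s'| ≤ K * |s - s'|)
    {M : ℕ} (hM : 1 ≤ M) {ρ : ℕ → ℝ} (hρ : ∀ i, ρ i = -R + i * (2 * R / M)) {r : ℝ}
    (hr : r ∈ Icc (-R) R) (hK : 0 ≤ K) :
    |F₁ r - F₂ r| ≤ 2 * K * (2 * R / M) + (|F₁ (ρ 0) - F₂ (ρ 0)| +
      ∑ i ∈ Finset.range M, |(F₁ (ρ (i + 1)) - F₁ (ρ i)) - (F₂ (ρ (i + 1)) - F₂ (ρ i))|) := by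
  have hM' : (0 : ℝ) < M := by exact_mod_cast hM
  set δ := 2 * R / M with hδ
  have hδ0 : 0 < δ := by positivity
  -- `ρ k` is the last node not exceeding `r`. Replacing `r` by it costs `K δ` for each of the two
  -- functions.
  set k := ⌊(r + R) / δ⌋₊ with hk
  have hq0 : 0 ≤ (r + R) / δ := div_nonneg (by linarith [hr.1]) hδ0.le
  have hk1 : (k : ℝ) ≤ (r + R) / δ := Nat.floor_le hq0
  have hk2 : (r + R) / δ < k + 1 := Nat.lt_floor_add_one _
  rw [le_div_iff₀ hδ0] at hk1
  rw [div_lt_iff₀ hδ0] at hk2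
  have hMδ : M * δ = 2 * R := by rw [hδ]; field_simp
  have hkM : k ≤ M := by
    have : (k : ℝ) * δ ≤ M * δ := by rw [hMδ]; linarith [hr.2]
    exact_mod_cast le_of_mul_le_mul_right this hδ0
  have hρk : ρ k ∈ Icc (-R) R := by
    rw [hρ]
    constructor
    · have : 0 ≤ (k : ℝ) * δ := by positivity
      linarith
    · linarith [hr.2]
  have hd : |r - ρ k| ≤ δ := by
    rw [hρ, abs_le]
    constructor <;> linarith
  have htel : (F₁ (ρ k) - F₂ (ρ k)) = (F₁ (ρ 0) - F₂ (ρ 0)) + ∑ i ∈ Finset.range k,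
      ((F₁ (ρ (i + 1)) - F₁ (ρ i)) - (F₂ (ρ (i + 1)) - F₂ (ρ i))) := by
    rw [Finset.sum_sub_distrib, Finset.sum_range_sub (fun i => F₁ (ρ i)),
      Finset.sum_range_sub (fun i => F₂ (ρ i))]
    ring
  have e : F₁ r - F₂ r = (F₁ r - F₁ (ρ k)) + (F₁ (ρ k) - F₂ (ρ k)) - (F₂ r - F₂ (ρ k)) := by ring
  have b1 : |F₁ r - F₁ (ρ k)| ≤ K * δ := (h₁ r hr _ hρk).trans (by gcongr)
  have b2 : |F₂ r - F₂ (ρ k)| ≤ K * δ := (h₂ r hr _ hρk).trans (by gcongr)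
  have b3 : |F₁ (ρ k) - F₂ (ρ k)| ≤ |F₁ (ρ 0) - F₂ (ρ 0)| +
      ∑ i ∈ Finset.range M, |(F₁ (ρ (i + 1)) - F₁ (ρ i)) - (F₂ (ρ (i + 1)) - F₂ (ρ i))| := by
    rw [htel]
    refine (abs_add_le _ _).trans ?_
    gcongr
    refine (Finset.abs_sum_le_sum_abs _ _).trans ?_
    -- The telescoping sum stops at `k`, which depends on `r`. All `M` terms are kept so that the
    -- bound is the same for every `r`.
    exact Finset.sum_le_sum_of_subset_of_nonneg (Finset.range_mono hkM)
      fun i _ _ => abs_nonneg _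
  calc |F₁ r - F₂ r| ≤ |F₁ r - F₁ (ρ k)| + |F₁ (ρ k) - F₂ (ρ k)| + |F₂ r - F₂ (ρ k)| := by
        rw [e]
        exact (abs_sub _ _).trans (by gcongr; exact abs_add_le _ _)
    _ ≤ _ := by linarith

theorem integrable_mul_comp {X : Type*} [MeasurableSpace X] {μ : Measure X} {j a : X → ℝ}
    {A : ℝ → ℝ} {M : ℝ} (hA : Continuous A) (hj : Integrable j μ) (ha : AEStronglyMeasurable a μ)
    (hM : ∀ᵐ y ∂μ, |A (a y)| ≤ M) : Integrable (fun y => j y * A (a y)) μ :=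
  hj.mul_bdd (c := M) (hA.comp_aestronglyMeasurable ha) hM

/-- The splitting is `j₁ A(a) - j₂ A(b) = A(a) (j₁ - j₂) + j₂ (A(a) - A(b))`. It serves both for the
oscillation of the solution, where the kernels differ, and for the residual of the scheme, where
they coincide. -/
theorem enorm_integral_mul_comp_sub_le {X : Type*} [MeasurableSpace X] {μ : Measure X}
    {j₁ j₂ a b : X → ℝ} {A : ℝ → ℝ} {M Λ : ℝ} (hA : Continuous A) (hj₁ : Integrable j₁ μ)
    (hj₂ : Integrable j₂ μ) (ha : AEStronglyMeasurable a μ) (hb : AEStronglyMeasurable b μ)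
    (hMa : ∀ᵐ y ∂μ, |A (a y)| ≤ M) (hMb : ∀ᵐ y ∂μ, |A (b y)| ≤ M)
    (hL : ∀ᵐ y ∂μ, |A (a y) - A (b y)| ≤ Λ * |a y - b y|) :
    ‖(∫ y, j₁ y * A (a y) ∂μ) - ∫ y, j₂ y * A (b y) ∂μ‖ₑ ≤
      ENNReal.ofReal M * (∫⁻ y, ‖j₁ y - j₂ y‖ₑ ∂μ) +
        ∫⁻ y, ‖j₂ y‖ₑ * (ENNReal.ofReal Λ * ‖a y - b y‖ₑ) ∂μ := by
  rw [← integral_sub (integrable_mul_comp hA hj₁ ha hMa) (integrable_mul_comp hA hj₂ hb hMb)]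
  refine (enorm_integral_le_lintegral_enorm _).trans ?_
  rw [← lintegral_const_mul' _ _ ENNReal.ofReal_ne_top, ← lintegral_add_left']
  · refine lintegral_mono_ae ?_
    filter_upwards [hMa, hL] with y h1 h2
    have e : j₁ y * A (a y) - j₂ y * A (b y) =
        A (a y) * (j₁ y - j₂ y) + j₂ y * (A (a y) - A (b y)) := by ring
    rw [e]
    refine (enorm_add_le _ _).trans ?_
    rw [enorm_mul, enorm_mul]
    refine add_le_add ?_ ?_
    · gcongr
      rw [← ofReal_norm]
      exact ENNReal.ofReal_le_ofReal h1
    · gcongr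
      rw [← ofReal_norm, ← ofReal_norm, ← ENNReal.ofReal_mul' (norm_nonneg _)]
      exact ENNReal.ofReal_le_ofReal h2
  · exact ((hj₁.aestronglyMeasurable.sub hj₂.aestronglyMeasurable).enorm).const_mul _

end Pointwise

/-! ### Slices, data and elementary properties of solutions. -/

section

variable {d : ℕ} {T L : ℝ} {J : (Fin d → ℝ) × (Fin d → ℝ) → ℝ} {A : ℝ → ℝ}
  {f : ℝ → (Fin d → ℝ) → ℝ → ℝ} {u₀ : (Fin d → ℝ) → ℝ} {u : ℝ → (Fin d → ℝ) → ℝ}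

section Slices

theorem volume_restrict_cylinder (d : ℕ) (T L : ℝ) :
    (volume.restrict (cylinder d T L)) =
      (volume.restrict (Ioo 0 T)).prod (volume.restrict (cube d L)) := by
  rw [cylinder, Measure.prod_restrict, Measure.volume_eq_prod]

theorem volume_restrict_cube_prod_cube (d : ℕ) (L : ℝ) :
    (volume.restrict (cube d L ×ˢ cube d L)) =
      (volume.restrict (cube d L)).prod (volume.restrict (cube d L)) := by
  rw [Measure.prod_restrict, Measure.volume_eq_prod]

theorem ae_ae_of_ae_cylinder {P : ℝ × (Fin d → ℝ) → Prop}
    (h : ∀ᵐ z ∂(volume.restrict (cylinder d T L)), P z) :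
    ∀ᵐ x ∂(volume.restrict (cube d L)), ∀ᵐ s ∂(volume.restrict (Ioo 0 T)), P (s, x) := by
  rw [volume_restrict_cylinder] at h
  exact Measure.ae_ae_of_ae_prod
    (Measure.measurePreserving_swap.quasiMeasurePreserving.ae h)

theorem ae_integrable_slice_of_cylinder {v : ℝ × (Fin d → ℝ) → ℝ}
    (hv : IntegrableOn v (cylinder d T L)) :
    ∀ᵐ x ∂(volume.restrict (cube d L)), IntegrableOn (fun s => v (s, x)) (Ioo 0 T) := by
  rw [IntegrableOn, volume_restrict_cylinder] at hv
  exact hv.prod_left_ae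

end Slices

section Data

theorem RangeKernel.continuous (hA : RangeKernel A) : Continuous A := hA.lipschitz.continuous

theorem RangeKernel.map_zero (hA : RangeKernel A) : A 0 = 0 := by
  have := hA.odd 0
  rw [neg_zero] at this
  linarith

theorem RangeKernel.exists_lipschitz (hA : RangeKernel A) (R : ℝ) :
    ∃ Λ : ℝ, 0 < Λ ∧ ∀ a ∈ Icc (-R) R, ∀ b ∈ Icc (-R) R, |A a - A b| ≤ Λ * |a - b| := by
  obtain ⟨K, hK⟩ := (hA.lipschitz.locallyLipschitzOn (s := Icc (-R) R)).exists_lipschitzOnWith_of_compact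
    isCompact_Icc
  refine ⟨K + 1, by positivity, fun a ha b hb => ?_⟩
  have := hK.dist_le_mul a ha b hb
  rw [Real.dist_eq, Real.dist_eq] at this
  refine this.trans ?_
  gcongr
  linarith

theorem RangeKernel.abs_apply_le (hA : RangeKernel A) {R Λ : ℝ} (hR : 0 ≤ R) (hΛ : 0 ≤ Λ)
    (hL : ∀ a ∈ Icc (-R) R, ∀ b ∈ Icc (-R) R, |A a - A b| ≤ Λ * |a - b|) {a : ℝ}
    (ha : a ∈ Icc (-R) R) : |A a| ≤ Λ * R := by
  have := hL a ha 0 ⟨by linarith, hR⟩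
  rw [hA.map_zero, sub_zero, sub_zero] at this
  refine this.trans ?_
  gcongr
  exact abs_le.2 ha

theorem SpatialKernel.ae_integrable (hJ : SpatialKernel L J) :
    ∀ᵐ x ∂(volume.restrict (cube d L)), IntegrableOn (fun y => J (x, y)) (cube d L) := by
  have h := hJ.bv.1
  rw [IntegrableOn, volume_restrict_cube_prod_cube] at h
  exact h.prod_right_ae

theorem SpatialKernel.ae_symm (hJ : SpatialKernel L J) :
    ∀ᵐ x ∂(volume.restrict (cube d L)), ∀ᵐ y ∂(volume.restrict (cube d L)),
      J (y, x) = J (x, y) := by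
  have h := hJ.symm
  rw [volume_restrict_cube_prod_cube] at h
  exact Measure.ae_ae_of_ae_prod h

theorem SpatialKernel.ae_nonneg (hJ : SpatialKernel L J) :
    ∀ᵐ x ∂(volume.restrict (cube d L)), ∀ᵐ y ∂(volume.restrict (cube d L)), 0 ≤ J (x, y) := by
  have h := hJ.nonneg
  rw [volume_restrict_cube_prod_cube] at h
  exact Measure.ae_ae_of_ae_prod h

theorem Reaction.exists_lipschitz (hf : Reaction T L f) (R : ℝ) :
    ∃ K : ℝ, 0 ≤ K ∧ ∀ᵐ x ∂(volume.restrict (cube d L)), ∀ᵐ t ∂(volume.restrict (Ioo 0 T)),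
      ∀ s ∈ Icc (-R) R, ∀ s' ∈ Icc (-R) R, |f t x s - f t x s'| ≤ K * |s - s'| := by
  obtain ⟨K, hK⟩ := hf.lipschitz_sup R
  refine ⟨max K 0, le_max_right _ _, ae_ae_of_ae_cylinder (P := fun z => ∀ s ∈ Icc (-R) R, ∀ s' ∈ Icc (-R) R,
    |f z.1 z.2 s - f z.1 z.2 s'| ≤ max K 0 * |s - s'|) ?_⟩
  filter_upwards [hK] with z hz s hs s' hs'
  refine (hz s hs s' hs').trans ?_
  gcongr
  exact le_max_left _ _

theorem IsBV.sub {E : Type*} [NormedAddCommGroup E] [NormedSpace ℝ E] [MeasureSpace E]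
    {U : Set E} {v w : E → ℝ} (hv : IsBV U v) (hw : IsBV U w)
    (h : variation U (fun x => v x - w x) < ∞) : IsBV U fun x => v x - w x :=
  ⟨hv.1.sub hw.1, h⟩

end Data

section Solution

theorem InitialDatum.exists_bound (hu₀ : InitialDatum L u₀) :
    ∃ B : ℝ, 0 ≤ B ∧ ∀ᵐ x ∂(volume.restrict (cube d L)), |u₀ x| ≤ B := by
  refine ⟨(eLpNorm u₀ ∞ (volume.restrict (cube d L))).toReal, ENNReal.toReal_nonneg, ?_⟩
  have h := hu₀.bounded.2
  rw [eLpNorm_exponent_top] at h ⊢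
  filter_upwards [ae_le_eLpNormEssSup (f := u₀) (μ := volume.restrict (cube d L))] with x hx
  rw [← Real.norm_eq_abs, ← toReal_enorm]
  exact ENNReal.toReal_mono h.ne hx

/-- Joint measurability yields measurable slices for almost every time only. Such times are dense in
`[0, T]`, and continuity in time makes any other slice an almost everywhere limit of measurable
ones. -/
theorem IsSolution.aestronglyMeasurable (hT : 0 < T) (hu : IsSolution T L J A f u₀ u) {t : ℝ}
    (ht : t ∈ Icc 0 T) : AEStronglyMeasurable (u t) (volume.restrict (cube d L)) := by
  have h1 := hu.measurable
  rw [volume_restrict_cylinder] at h1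
  have h2 : ∀ᵐ s ∂(volume.restrict (Ioo 0 T)),
      AEStronglyMeasurable (u s) (volume.restrict (cube d L)) := h1.prodMk_left
  have h3 : t ∈ closure {s | s ∈ Ioo 0 T ∧ AEStronglyMeasurable (u s) (volume.restrict (cube d L))} := by
    have hd : Ioo (0 : ℝ) T ⊆
        closure {s | s ∈ Ioo 0 T ∧ AEStronglyMeasurable (u s) (volume.restrict (cube d L))} := by
      intro s hs
      rw [mem_closure_iff]
      intro o ho hso
      by_contra hne
      have hnull : volume (o ∩ Ioo 0 T) = 0 := by
        refine measure_mono_null ?_ ((ae_restrict_iff' measurableSet_Ioo).1 h2)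
        rintro r ⟨hro, hr⟩ hbad
        exact hne ⟨r, hro, hr, hbad hr⟩
      exact ((ho.inter isOpen_Ioo).measure_pos volume ⟨s, hso, hs⟩).ne' hnull
    have := closure_minimal hd isClosed_closure
    rw [closure_Ioo hT.ne] at this
    exact this ht
  obtain ⟨τ, hτ, hlim⟩ := mem_closure_iff_seq_limit.1 h3
  refine aestronglyMeasurable_of_tendsto_ae Filter.atTop (fun n => (hτ n).2) ?_
  obtain ⟨K, hK⟩ := hu.lipschitz
  filter_upwards [hK] with x hx
  have hc := hx.continuousOn t ht
  refine hc.tendsto.comp (tendsto_nhdsWithin_iff.2 ⟨hlim, Filter.Eventually.of_forall fun n => ?_⟩)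
  exact Ioo_subset_Icc_self (hτ n).1

theorem IsSolution.exists_bound (hT : 0 < T) (hu₀ : InitialDatum L u₀)
    (hu : IsSolution T L J A f u₀ u) :
    ∃ R : ℝ, 0 < R ∧ ∀ᵐ x ∂(volume.restrict (cube d L)), ∀ t ∈ Icc 0 T, |u t x| ≤ R := by
  obtain ⟨B, hB, hBx⟩ := hu₀.exists_bound
  obtain ⟨K, hK⟩ := hu.lipschitz
  refine ⟨B + K * T + 1, by positivity, ?_⟩
  filter_upwards [hBx, hK, hu.initial] with x h1 h2 h3 t ht
  have h4 := h2.dist_le_mul t ht 0 ⟨le_rfl, hT.le⟩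
  rw [Real.dist_eq, Real.dist_eq, sub_zero, h3, abs_of_nonneg ht.1] at h4
  have h5 : (K : ℝ) * t ≤ K * T := mul_le_mul_of_nonneg_left ht.2 K.2
  have h6 : |u t x| ≤ |u₀ x| + |u t x - u₀ x| := by
    have := abs_add_le (u₀ x) (u t x - u₀ x)
    simpa using this
  linarith

end Solution

/-! ### Oscillation of the solution within cells. -/

section Oscillation

/-- Pointwise Gronwall estimate of the oscillation of a solution. -/
theorem IsSolution.exists_enorm_sub_le (hT : 0 < T) (hJ : SpatialKernel L J) (hA : RangeKernel A)
    (hf : Reaction T L f) (hu₀ : InitialDatum L u₀) (hu : IsSolution T L J A f u₀ u) :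
    ∃ R E M K : ℝ, 0 < R ∧ 0 ≤ K ∧ ∃ S : (Fin d → ℝ) → Prop,
      (∀ᵐ x ∂(volume.restrict (cube d L)), S x) ∧ ∀ x x', S x → S x' →
      ∀ k : ℕ, 1 ≤ k → ∀ ρ : ℕ → ℝ, (∀ i, ρ i = -R + i * (2 * R / k)) → ∀ t ∈ Icc 0 T,
      ‖u t x - u t x'‖ₑ ≤ ENNReal.ofReal E * (‖u₀ x - u₀ x'‖ₑ + ∫⁻ s in Ioo 0 T,
        ((ENNReal.ofReal M * (∫⁻ y in cube d L, ‖J (x, y) - J (x', y)‖ₑ) +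
          ENNReal.ofReal (2 * K * (2 * R / k))) + (‖f s x (ρ 0) - f s x' (ρ 0)‖ₑ +
          ∑ i ∈ Finset.range k, ‖(f s x (ρ (i + 1)) - f s x (ρ i)) -
            (f s x' (ρ (i + 1)) - f s x' (ρ i))‖ₑ))) := by
  obtain ⟨R, hR, hRx⟩ := hu.exists_bound hT hu₀
  obtain ⟨Λ, hΛ, hΛl⟩ := hA.exists_lipschitz (2 * R)
  obtain ⟨K, hK, hKx⟩ := hf.exists_lipschitz R
  obtain ⟨KJ, hKJ⟩ := hJ.marginal
  obtain ⟨Ku, hKu⟩ := hu.lipschitz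
  -- `Λ * KJ` comes from the nonlocal term and `K` from the reaction; the summand `1` makes `c`
  -- positive.
  set c : ℝ := Λ * KJ + K + 1 with hc
  -- `S` lists the properties that hold for almost every point. The estimate is then valid for every
  -- pair of good points and every partition, and no exceptional set depends on the pair.
  refine ⟨R, Real.exp (c * T), Λ * (2 * R), K, hR, hK, fun x =>
    (∀ t ∈ Icc 0 T, |u t x| ≤ R) ∧
    (∀ᵐ t ∂(volume.restrict (Ioo 0 T)),
      ∀ s ∈ Icc (-R) R, ∀ s' ∈ Icc (-R) R, |f t x s - f t x s'| ≤ K * |s - s'|) ∧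
    (∫⁻ y in cube d L, ‖J (x, y)‖ₑ ≤ KJ) ∧ LipschitzOnWith Ku (fun t => u t x) (Icc 0 T) ∧
    IntegrableOn (fun y => J (x, y)) (cube d L) ∧ u 0 x = u₀ x ∧
    ∀ᵐ t ∂(volume.restrict (Ioo 0 T)),
      HasDerivAt (fun s => u s x) (nonlocalOp L J A (u t) x + f t x (u t x)) t, ?_, ?_⟩
  · filter_upwards [hRx, hKx, hKJ, hKu, hJ.ae_integrable, hu.initial, hu.equation]
      with x h1 h2 h3 h4 h5 h6 h7
    exact ⟨h1, h2, h3, h4, h5, h6, h7⟩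
  rintro x x' ⟨a1, a2, -, a4, a5, a6, a7⟩ ⟨b1, b2, b3, b4, b5, b6, b7⟩ k hk ρ hρ t ht
  have hcpos : 0 < c := by positivity
  rw [← a6, ← b6]
  refine enorm_le_exp_mul_of_ae_deriv_le (p := fun s => u s x - u s x')
    (p' := fun s => (nonlocalOp L J A (u s) x + f s x (u s x)) -
      (nonlocalOp L J A (u s) x' + f s x' (u s x'))) hcpos (a4.sub b4) ?_ ?_ ht
  · filter_upwards [a7, b7] with s h1 h2
    exact h1.sub h2
  have hmem : ∀ᵐ s ∂(volume.restrict (Ioo 0 T)), s ∈ Ioo 0 T := ae_restrict_mem measurableSet_Ioo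
  filter_upwards [a2, b2, hmem] with s h1 h2 hs
  have hs' : s ∈ Icc 0 T := Ioo_subset_Icc_self hs
  have hus := hu.aestronglyMeasurable hT hs'
  have hxR := abs_le.1 (a1 s hs')
  have hxR' := abs_le.1 (b1 s hs')
  have hsub : ∀ z, |u s z| ≤ R → ∀ᵐ y ∂(volume.restrict (cube d L)),
      u s y - u s z ∈ Icc (-(2 * R)) (2 * R) := by
    intro z hz
    filter_upwards [hRx] with y hy
    have := abs_le.1 (hy s hs')
    have := abs_le.1 hz
    constructor <;> linarith
  have hAb : ∀ z, |u s z| ≤ R → ∀ᵐ y ∂(volume.restrict (cube d L)),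
      |A (u s y - u s z)| ≤ Λ * (2 * R) := fun z hz =>
    (hsub z hz).mono fun y hy => hA.abs_apply_le (by positivity) hΛ.le hΛl hy
  have hnl : ‖nonlocalOp L J A (u s) x - nonlocalOp L J A (u s) x'‖ₑ ≤
      ENNReal.ofReal (Λ * (2 * R)) * (∫⁻ y in cube d L, ‖J (x, y) - J (x', y)‖ₑ) +
        ENNReal.ofReal (Λ * KJ) * ‖u s x - u s x'‖ₑ := by
    refine (enorm_integral_mul_comp_sub_le (Λ := Λ) hA.continuous a5 b5
      (hus.sub aestronglyMeasurable_const) (hus.sub aestronglyMeasurable_const)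
      (hAb x (a1 s hs')) (hAb x' (b1 s hs')) ?_).trans ?_
    · filter_upwards [hsub x (a1 s hs'), hsub x' (b1 s hs')] with y g1 g2
      exact hΛl _ g1 _ g2
    · refine add_le_add le_rfl ?_
      -- The two arguments of `A` differ by a quantity independent of `y`, which leaves the integral
      -- and meets the bounded marginal of `J`.
      have e : ∀ y, ‖u s y - u s x - (u s y - u s x')‖ₑ = ‖u s x - u s x'‖ₑ := by
        intro y
        rw [sub_sub_sub_cancel_left, enorm_sub_rev]
      simp only [Pi.sub_apply, e]
      rw [lintegral_mul_const' _ _ (by finiteness), ENNReal.ofReal_mul hΛ.le, mul_comm,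
        mul_right_comm]
      gcongr
      simpa using b3
  have hfl : ‖f s x (u s x) - f s x' (u s x')‖ₑ ≤ ENNReal.ofReal K * ‖u s x - u s x'‖ₑ +
      (ENNReal.ofReal (2 * K * (2 * R / k)) + (‖f s x (ρ 0) - f s x' (ρ 0)‖ₑ +
          ∑ i ∈ Finset.range k, ‖(f s x (ρ (i + 1)) - f s x (ρ i)) -
            (f s x' (ρ (i + 1)) - f s x' (ρ i))‖ₑ)) := by
    have g1 := h1 (u s x) hxR (u s x') hxR'
    have g2 := abs_sub_le_sum_increments hR h1 h2 hk hρ hxR' hK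
    have g3 : |f s x (u s x) - f s x' (u s x')| ≤ K * |u s x - u s x'| +
        (2 * K * (2 * R / k) + (|f s x (ρ 0) - f s x' (ρ 0)| +
          ∑ i ∈ Finset.range k, |(f s x (ρ (i + 1)) - f s x (ρ i)) -
            (f s x' (ρ (i + 1)) - f s x' (ρ i))|)) := by
      have := abs_add_le (f s x (u s x) - f s x (u s x')) (f s x (u s x') - f s x' (u s x'))
      rw [sub_add_sub_cancel] at this
      linarith
    have hs0 : 0 ≤ ∑ i ∈ Finset.range k, |(f s x (ρ (i + 1)) - f s x (ρ i)) -
            (f s x' (ρ (i + 1)) - f s x' (ρ i))| := Finset.sum_nonneg fun i _ => abs_nonneg _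
    simp only [Real.enorm_eq_ofReal_abs]
    rw [← ENNReal.ofReal_mul hK, ← ENNReal.ofReal_sum_of_nonneg fun i _ => abs_nonneg _,
      ← ENNReal.ofReal_add (abs_nonneg _) hs0, ← ENNReal.ofReal_add (by positivity) (by positivity),
      ← ENNReal.ofReal_add (by positivity) (by positivity)]
    exact ENNReal.ofReal_le_ofReal g3
  rw [add_sub_add_comm]
  refine (enorm_add_le _ _).trans ((add_le_add hnl hfl).trans ?_)
  have hc' : ENNReal.ofReal (Λ * KJ) + ENNReal.ofReal K ≤ ENNReal.ofReal c := by
    rw [← ENNReal.ofReal_add (by positivity) hK]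
    exact ENNReal.ofReal_le_ofReal (by linarith)
  refine le_trans (le_of_eq ?_) (add_le_add_left (mul_le_mul_left hc' ‖u s x - u s x'‖ₑ) _)
  ring

end Oscillation

end

section

variable {d : ℕ} {T L : ℝ} {J : (Fin d → ℝ) × (Fin d → ℝ) → ℝ} {A : ℝ → ℝ}
  {f : ℝ → (Fin d → ℝ) → ℝ → ℝ} {u₀ : (Fin d → ℝ) → ℝ} {u : ℝ → (Fin d → ℝ) → ℝ}

/-- The product estimate concerns the second variable of `J`; symmetry transfers it to the first. -/
theorem SpatialKernel.exists_oscillation (hJ : SpatialKernel L J) :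
    ∃ O : (Fin d → ℝ) × (Fin d → ℝ) → ℝ≥0∞, Measurable O ∧
      (∀ᵐ x ∂(volume.restrict (cube d L)), ∀ᵐ x' ∂(volume.restrict (cube d L)),
        ∫⁻ y in cube d L, ‖J (x, y) - J (x', y)‖ₑ = O (x, x')) ∧
      ∀ (m : ℕ) (h : ℝ), 0 < h → m * h = L → ∫⁻ p, O p ∂(cellPairMeasure d m h) ≤
        ENNReal.ofReal h * variation (cube d L ×ˢ cube d L) J * ENNReal.ofReal (2 * h) ^ d := by
  obtain ⟨O, h1, h2, h3⟩ := hJ.bv.exists_oscillation_prod (isOpen_cube d L) (convex_cube d L)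
  refine ⟨O, h1, ?_, h3⟩
  filter_upwards [h2, hJ.ae_symm] with x hx hxs
  filter_upwards [hx, hJ.ae_symm] with x' hx' hxs'
  rw [← hx']
  refine lintegral_congr_ae ?_
  filter_upwards [hxs, hxs'] with y g1 g2
  rw [g1, g2]

theorem Reaction.exists_oscillation_increment (hf : Reaction T L f) {r r' : ℝ}
    (h : variation (cylinder d T L) (fun z => f z.1 z.2 r - f z.1 z.2 r') < ∞) :
    ∃ O : (Fin d → ℝ) × (Fin d → ℝ) → ℝ≥0∞, Measurable O ∧
      (∀ᵐ x ∂(volume.restrict (cube d L)), ∀ᵐ x' ∂(volume.restrict (cube d L)),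
        ∫⁻ s in Ioo 0 T, ‖(f s x r - f s x r') - (f s x' r - f s x' r')‖ₑ = O (x, x')) ∧
      ∀ (m : ℕ) (h : ℝ), 0 < h → m * h = L → ∫⁻ p, O p ∂(cellPairMeasure d m h) ≤
        ENNReal.ofReal h * variation (cylinder d T L) (fun z => f z.1 z.2 r - f z.1 z.2 r') *
          ENNReal.ofReal (2 * h) ^ d :=
  ((hf.bv r).sub (hf.bv r') h).exists_oscillation_prod isOpen_Ioo (convex_Ioo 0 T)

theorem Reaction.exists_oscillation (hf : Reaction T L f) (r : ℝ) :
    ∃ O : (Fin d → ℝ) × (Fin d → ℝ) → ℝ≥0∞, Measurable O ∧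
      (∀ᵐ x ∂(volume.restrict (cube d L)), ∀ᵐ x' ∂(volume.restrict (cube d L)),
        ∫⁻ s in Ioo 0 T, ‖f s x r - f s x' r‖ₑ = O (x, x')) ∧
      ∀ (m : ℕ) (h : ℝ), 0 < h → m * h = L → ∫⁻ p, O p ∂(cellPairMeasure d m h) ≤
        ENNReal.ofReal h * variation (cylinder d T L) (fun z => f z.1 z.2 r) *
          ENNReal.ofReal (2 * h) ^ d :=
  (hf.bv r).exists_oscillation_prod isOpen_Ioo (convex_Ioo 0 T)

/-- The solution has the same `L¹` oscillation in the cells as a function of bounded variation. -/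
theorem IsSolution.exists_oscillation_le (hT : 0 < T) (hL : 0 < L) (hJ : SpatialKernel L J)
    (hA : RangeKernel A) (hf : Reaction T L f) (hu₀ : InitialDatum L u₀)
    (hu : IsSolution T L J A f u₀ u) :
    ∃ C : ℝ≥0∞, C ≠ ∞ ∧ ∀ (m : ℕ) (h : ℝ), 0 < h → m * h = L → ∀ t ∈ Icc 0 T,
      ∑ j : Fin d → Fin m, ∫⁻ x in cell h j, ∫⁻ x' in cell h j, ‖u t x - u t x'‖ₑ ≤
        C * ENNReal.ofReal h * ENNReal.ofReal h ^ d := by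
  obtain ⟨R, E, M, K, hR, hK, S, hS, hbound⟩ := hu.exists_enorm_sub_le hT hJ hA hf hu₀
  obtain ⟨Ou, hOum, hOu, hOui⟩ := hu₀.bv.exists_oscillation
  obtain ⟨OJ, hOJm, hOJ, hOJi⟩ := hJ.exists_oscillation
  obtain ⟨Of, hOfm, hOf, hOfi⟩ := hf.exists_oscillation (-R)
  obtain ⟨Kv, hKv⟩ := hf.lipschitz_bv R
  have hVu := hu₀.bv.2
  have hVJ := hJ.bv.2
  have hVf := (hf.bv (-R)).2
  set Vu := variation (cube d L) u₀
  set VJ := variation (cube d L ×ˢ cube d L) J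
  set Vf := variation (cylinder d T L) fun z => f z.1 z.2 (-R)
  -- The summands come from `u₀`, from `J`, from rounding to the nodes, from `f` at the first node
  -- `-R`, and from the increments of `f`. The factors `2 ^ d` are those of the ball volume
  -- `(2h)^d`.
  refine ⟨ENNReal.ofReal E * (Vu * 2 ^ d + ((ENNReal.ofReal M * (VJ * 2 ^ d) +
    ENNReal.ofReal (4 * K * R / L) * ENNReal.ofReal L ^ d) * ENNReal.ofReal T +
      (Vf * 2 ^ d + ENNReal.ofReal (Kv * (2 * R)) * 2 ^ d))), by finiteness, ?_⟩
  intro m h hh hmh t ht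
  have hmpos : (0 : ℝ) < m := by
    by_contra hm
    have : (m : ℝ) = 0 := le_antisymm (not_lt.1 hm) (by positivity)
    rw [this, zero_mul] at hmh
    exact hL.ne hmh
  have hm1 : 1 ≤ m := by exact_mod_cast hmpos
  -- The value interval gets as many pieces as the mesh has cells per direction, so its step is `2 R
  -- h / L` and rounding costs `O(h)`.
  set ρ : ℕ → ℝ := fun i => -R + i * (2 * R / m) with hρ
  have hρmem : ∀ i, i ≤ m → ρ i ∈ Icc (-R) R := by
    intro i hi
    have hi' : (i : ℝ) ≤ m := by exact_mod_cast hi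
    have h1 : (i : ℝ) * (2 * R / m) ≤ m * (2 * R / m) := by gcongr
    have h2 : (m : ℝ) * (2 * R / m) = 2 * R := by field_simp
    have h3 : 0 ≤ (i : ℝ) * (2 * R / m) := by positivity
    constructor <;> simp only [hρ] <;> linarith
  have hvar : ∀ i, i < m → variation (cylinder d T L)
      (fun z => f z.1 z.2 (ρ (i + 1)) - f z.1 z.2 (ρ i)) ≤ ENNReal.ofReal (Kv * (2 * R / m)) := by
    intro i hi
    have := hKv (ρ (i + 1)) (hρmem _ hi) (ρ i) (hρmem _ hi.le)
    have e : |ρ (i + 1) - ρ i| = 2 * R / m := by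
      have : ρ (i + 1) - ρ i = 2 * R / m := by
        simp only [hρ]
        push_cast
        ring
      rw [this, abs_of_nonneg (by positivity)]
    rwa [e] at this
  have hex : ∀ i, ∃ O : (Fin d → ℝ) × (Fin d → ℝ) → ℝ≥0∞, Measurable O ∧ (i < m →
      (∀ᵐ x ∂(volume.restrict (cube d L)), ∀ᵐ x' ∂(volume.restrict (cube d L)),
        ∫⁻ s in Ioo 0 T, ‖(f s x (ρ (i + 1)) - f s x (ρ i)) -
          (f s x' (ρ (i + 1)) - f s x' (ρ i))‖ₑ = O (x, x')) ∧
      ∫⁻ p, O p ∂(cellPairMeasure d m h) ≤ ENNReal.ofReal h *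
        ENNReal.ofReal (Kv * (2 * R / m)) * ENNReal.ofReal (2 * h) ^ d) := by
    intro i
    by_cases hi : i < m
    · obtain ⟨O, h1, h2, h3⟩ := hf.exists_oscillation_increment
        ((hvar i hi).trans_lt ENNReal.ofReal_lt_top)
      refine ⟨O, h1, fun _ => ⟨h2, (h3 m h hh hmh).trans ?_⟩⟩
      gcongr
      exact hvar i hi
    · exact ⟨0, measurable_zero, fun h => absurd h hi⟩
  choose O hOm hO using hex
  set κ : ℝ≥0∞ := ENNReal.ofReal (2 * K * (2 * R / m)) with hκ
  set P : (Fin d → ℝ) × (Fin d → ℝ) → ℝ≥0∞ := fun p => ENNReal.ofReal E * (Ou p +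
    ((ENNReal.ofReal M * OJ p + κ) * ENNReal.ofReal T +
      (Of p + ∑ i ∈ Finset.range m, O i p))) with hP
  have hOsum : Measurable fun p => ∑ i ∈ Finset.range m, O i p :=
    Finset.measurable_fun_sum _ fun i _ => hOm i
  have hPm : Measurable P := by fun_prop
  have hslice : ∀ᵐ x ∂(volume.restrict (cube d L)), ∀ i,
      AEMeasurable (fun s => f s x (ρ i)) (volume.restrict (Ioo 0 T)) := by
    rw [ae_all_iff]
    intro i
    filter_upwards [ae_integrable_slice_of_cylinder (hf.bv (ρ i)).1] with x hx
    exact hx.aestronglyMeasurable.aemeasurable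
  have hincr : ∀ᵐ x ∂(volume.restrict (cube d L)), ∀ᵐ x' ∂(volume.restrict (cube d L)),
      ∀ i ∈ Finset.range m, ∫⁻ s in Ioo 0 T, ‖(f s x (ρ (i + 1)) - f s x (ρ i)) -
          (f s x' (ρ (i + 1)) - f s x' (ρ i))‖ₑ = O i (x, x') := by
    have : ∀ᵐ x ∂(volume.restrict (cube d L)), ∀ i ∈ Finset.range m,
        ∀ᵐ x' ∂(volume.restrict (cube d L)),
        ∫⁻ s in Ioo 0 T, ‖(f s x (ρ (i + 1)) - f s x (ρ i)) -
          (f s x' (ρ (i + 1)) - f s x' (ρ i))‖ₑ = O i (x, x') :=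
      (Finset.eventually_all _).2 fun i hi => (hO i (Finset.mem_range.1 hi)).1
    filter_upwards [this] with x hx
    exact (Finset.eventually_all _).2 hx
  have hpt : ∀ᵐ x ∂(volume.restrict (cube d L)), ∀ᵐ x' ∂(volume.restrict (cube d L)),
      ‖u t x - u t x'‖ₑ ≤ P (x, x') := by
    filter_upwards [hS, hOu, hOJ, hOf, hincr, hslice] with x a1 a2 a3 a4 a5 a6
    filter_upwards [hS, a2, a3, a4, a5, hslice] with x' b1 b2 b3 b4 b5 b6
    refine (hbound x x' a1 b1 m hm1 ρ (fun _ => rfl) t ht).trans (le_of_eq ?_)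
    have hρ0 : ρ 0 = -R := by simp [hρ]
    have hm0 : AEMeasurable (fun s => ‖f s x (ρ 0) - f s x' (ρ 0)‖ₑ)
        (volume.restrict (Ioo 0 T)) := ((a6 0).sub (b6 0)).enorm
    have hmi : ∀ i ∈ Finset.range m, AEMeasurable (fun s => ‖(f s x (ρ (i + 1)) - f s x (ρ i)) -
          (f s x' (ρ (i + 1)) - f s x' (ρ i))‖ₑ) (volume.restrict (Ioo 0 T)) := fun i _ =>
      (((a6 (i + 1)).sub (a6 i)).sub ((b6 (i + 1)).sub (b6 i))).enorm
    rw [lintegral_add_left measurable_const, lintegral_add_left' hm0,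
      lintegral_finsetSum' _ hmi, Finset.sum_congr rfl b5, b3, b2, hρ0, b4, setLIntegral_const,
      Real.volume_Ioo, sub_zero]
  have hstep : ∑ j : Fin d → Fin m, ∫⁻ x in cell h j, ∫⁻ x' in cell h j, ‖u t x - u t x'‖ₑ ≤
      ∫⁻ p, P p ∂(cellPairMeasure d m h) := by
    rw [lintegral_cellPairMeasure hPm]
    refine Finset.sum_le_sum fun j _ => lintegral_mono_ae ?_
    have hsub : cell h j ⊆ cube d L := hmh ▸ cell_subset_cube hh j
    filter_upwards [ae_restrict_of_ae_restrict_of_subset hsub hpt] with x hx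
    exact lintegral_mono_ae (ae_restrict_of_ae_restrict_of_subset hsub hx)
  refine hstep.trans ?_
  have e1 : ENNReal.ofReal (2 * h) ^ d = 2 ^ d * ENNReal.ofReal h ^ d := by
    rw [ENNReal.ofReal_mul (by norm_num), mul_pow]
    simp
  have e2 : (m : ℝ≥0∞) * ENNReal.ofReal h = ENNReal.ofReal L := by
    rw [← hmh, ENNReal.ofReal_mul (by positivity)]
    simp
  have e3 : κ = ENNReal.ofReal (4 * K * R / L) * ENNReal.ofReal h := by
    rw [hκ, ← ENNReal.ofReal_mul (by positivity), ← hmh]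
    congr 1
    field_simp
    ring
  -- Each of the `m` increments has variation at most `Kv * (2 * R / m)`, so their sum does not grow
  -- with `m`. This is where Lipschitz continuity of `f` in total variation is needed.
  have e4 : ∑ i ∈ Finset.range m, ∫⁻ p, O i p ∂(cellPairMeasure d m h) ≤
      ENNReal.ofReal h * ENNReal.ofReal (Kv * (2 * R)) * ENNReal.ofReal (2 * h) ^ d := by
    refine (Finset.sum_le_sum fun i hi => (hO i (Finset.mem_range.1 hi)).2).trans ?_
    rw [Finset.sum_const, Finset.card_range, nsmul_eq_mul]
    have : ENNReal.ofReal (Kv * (2 * R)) = m * ENNReal.ofReal (Kv * (2 * R / m)) := by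
      rw [← ENNReal.ofReal_natCast, ← ENNReal.ofReal_mul (by positivity)]
      congr 1
      field_simp
    rw [this]
    apply le_of_eq
    ring
  calc ∫⁻ p, P p ∂(cellPairMeasure d m h)
      = ENNReal.ofReal E * (∫⁻ p, Ou p ∂(cellPairMeasure d m h) +
        ((ENNReal.ofReal M * ∫⁻ p, OJ p ∂(cellPairMeasure d m h) +
          κ * cellPairMeasure d m h univ) * ENNReal.ofReal T +
        (∫⁻ p, Of p ∂(cellPairMeasure d m h) +
          ∑ i ∈ Finset.range m, ∫⁻ p, O i p ∂(cellPairMeasure d m h)))) := by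
        rw [hP, lintegral_const_mul _ (by fun_prop), lintegral_add_left hOum,
          lintegral_add_left (by fun_prop), lintegral_mul_const _ (by fun_prop),
          lintegral_add_left (by fun_prop), lintegral_const_mul _ hOJm, lintegral_const,
          lintegral_add_left hOfm, lintegral_finsetSum _ fun i _ => hOm i]
    _ ≤ ENNReal.ofReal E * (ENNReal.ofReal h * Vu * ENNReal.ofReal (2 * h) ^ d +
        ((ENNReal.ofReal M * (ENNReal.ofReal h * VJ * ENNReal.ofReal (2 * h) ^ d) +
          κ * (ENNReal.ofReal L ^ d * ENNReal.ofReal h ^ d)) * ENNReal.ofReal T +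
        (ENNReal.ofReal h * Vf * ENNReal.ofReal (2 * h) ^ d +
          ENNReal.ofReal h * ENNReal.ofReal (Kv * (2 * R)) * ENNReal.ofReal (2 * h) ^ d))) := by
        rw [cellPairMeasure_univ, e2]
        gcongr
        · exact hOui m h hh hmh
        · exact hOJi m h hh hmh
        · exact hOfi m h hh hmh
    _ = _ := by
        rw [e1, e3]
        ring

end

/-! ### Bounds on the averaged data. -/

section

variable {d m : ℕ} {T L h τ : ℝ} {J : (Fin d → ℝ) × (Fin d → ℝ) → ℝ} {A : ℝ → ℝ}
  {f : ℝ → (Fin d → ℝ) → ℝ → ℝ} {u₀ : (Fin d → ℝ) → ℝ} {u : ℝ → (Fin d → ℝ) → ℝ}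

section Averages

theorem volume_real_cell (hh : 0 < h) (j : Fin d → Fin m) : volume.real (cell h j) = h ^ d := by
  rw [Measure.real, volume_cell, ENNReal.toReal_pow, ENNReal.toReal_ofReal hh.le]

theorem ae_cell_of_ae_cube (hh : 0 < h) (hmh : m * h = L) {p : (Fin d → ℝ) → Prop}
    (hp : ∀ᵐ x ∂(volume.restrict (cube d L)), p x) (j : Fin d → Fin m) :
    ∀ᵐ x ∂(volume.restrict (cell h j)), p x :=
  ae_restrict_of_ae_restrict_of_subset (hmh ▸ cell_subset_cube hh j) hp

theorem abs_cellAverage_le (hh : 0 < h) {v : (Fin d → ℝ) → ℝ} {B : ℝ} {j : Fin d → Fin m}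
    (hv : ∀ᵐ x ∂(volume.restrict (cell h j)), |v x| ≤ B) : |cellAverage h v j| ≤ B := by
  have h1 : ‖∫ x in cell h j, v x‖ ≤ B * volume.real (cell h j) :=
    norm_setIntegral_le_of_norm_le_const_ae (by rw [volume_cell]; finiteness) hv
  rw [volume_real_cell hh, Real.norm_eq_abs] at h1
  have hpos : 0 < h ^ d := by positivity
  rw [cellAverage, abs_mul, abs_of_pos (by positivity), one_div, inv_mul_le_iff₀ hpos, mul_comm]
  exact h1

theorem SpatialKernel.integrableOn_cell_prod (hJ : SpatialKernel L J) (hh : 0 < h)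
    (hmh : m * h = L) (j k : Fin d → Fin m) :
    Integrable J ((volume.restrict (cell h j)).prod (volume.restrict (cell h k))) := by
  rw [Measure.prod_restrict, ← Measure.volume_eq_prod]
  subst hmh
  exact hJ.bv.1.mono_set (prod_mono (cell_subset_cube hh j) (cell_subset_cube hh k))

theorem SpatialKernel.kernelAverage_nonneg (hJ : SpatialKernel L J) (hh : 0 < h) (hmh : m * h = L)
    (j k : Fin d → Fin m) : 0 ≤ kernelAverage h J j k := by
  refine mul_nonneg (by positivity) (integral_nonneg_of_ae ?_)
  filter_upwards [ae_cell_of_ae_cube hh hmh hJ.ae_nonneg j] with x hx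
  exact integral_nonneg_of_ae (ae_cell_of_ae_cube hh hmh hx k)

/-- The row sum is the mean over `Ω_j` of the marginal `∫_Ω J(x, y) dy`, whose bound does not depend
on the mesh. -/
theorem SpatialKernel.exists_sum_kernelAverage_le (hJ : SpatialKernel L J) :
    ∃ K : ℝ, 0 ≤ K ∧ ∀ (m : ℕ) (h : ℝ), 0 < h → m * h = L → ∀ j : Fin d → Fin m,
      h ^ d * ∑ k, kernelAverage h J j k ≤ K := by
  obtain ⟨K, hK⟩ := hJ.marginal
  refine ⟨K, K.2, ?_⟩
  rintro m h hh hmh j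
  have hsum : ∑ k : Fin d → Fin m, ∫ x in cell h j, ∫ y in cell h k, J (x, y) ≤ K * h ^ d := by
    rw [← integral_finsetSum _ fun k _ => (hJ.integrableOn_cell_prod hh hmh j k).integral_prod_left]
    refine (le_abs_self _).trans ?_
    rw [← volume_real_cell hh j, ← Real.norm_eq_abs]
    refine norm_setIntegral_le_of_norm_le_const_ae (by rw [volume_cell]; finiteness) ?_
    filter_upwards [ae_cell_of_ae_cube hh hmh hK j, ae_cell_of_ae_cube hh hmh hJ.ae_integrable j]
      with x h1 h2
    rw [← hmh] at h1 h2
    rw [← integral_cube_eq_sum hh h2]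
    have h3 := (enorm_integral_le_lintegral_enorm _).trans h1
    have h4 : ‖∫ y in cube d (m * h), J (x, y)‖₊ ≤ K := by exact_mod_cast h3
    exact_mod_cast h4
  have hpos : 0 < h ^ d := by positivity
  simp only [kernelAverage]
  rw [← Finset.mul_sum]
  calc h ^ d * (1 / h ^ (2 * d) * ∑ k : Fin d → Fin m, ∫ x in cell h j, ∫ y in cell h k, J (x, y))
      ≤ h ^ d * (1 / h ^ (2 * d) * (K * h ^ d)) := by gcongr
    _ = K := by
      rw [two_mul, pow_add]
      field_simp

theorem Ioo_time_subset {N n : ℕ} (hτ : 0 < τ) (hN : N * τ = T) (hn : n < N) :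
    Ioo (n * τ) ((n + 1) * τ) ⊆ Ioo 0 T := by
  refine Ioo_subset_Ioo (by positivity) ?_
  rw [← hN]
  have : (n : ℝ) + 1 ≤ N := by exact_mod_cast hn
  gcongr

theorem Reaction.exists_abs_reactionAverage_le (hf : Reaction T L f) :
    ∃ C : ℝ, 0 < C ∧ ∀ (N m : ℕ) (τ h : ℝ), 0 < τ → 0 < h → N * τ = T → m * h = L →
      ∀ n < N, ∀ (j : Fin d → Fin m) (s : ℝ), |reactionAverage τ h f n j s| ≤ C * (1 + |s|) := by
  obtain ⟨C, hC, hCf⟩ := hf.growth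
  refine ⟨C, hC, fun N m τ h hτ hh hN hmh n hn j s => ?_⟩
  rw [volume_restrict_cylinder] at hCf
  have h1 := Measure.ae_ae_of_ae_prod hCf
  have hle : (n : ℝ) * τ ≤ (n + 1) * τ := by nlinarith
  have h2 : ∀ᵐ t ∂(volume.restrict (Ioc (n * τ) ((n + 1) * τ))),
      ‖∫ x in cell h j, f t x s‖ ≤ C * (1 + |s|) * h ^ d := by
    rw [← restrict_Ioo_eq_restrict_Ioc]
    filter_upwards [ae_restrict_of_ae_restrict_of_subset (Ioo_time_subset hτ hN hn) h1] with t ht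
    rw [← volume_real_cell hh j]
    refine norm_setIntegral_le_of_norm_le_const_ae (by rw [volume_cell]; finiteness) ?_
    filter_upwards [ae_cell_of_ae_cube hh hmh ht j] with x hx
    exact hx s
  have h3 : ‖∫ t in (n * τ)..((n + 1) * τ), ∫ x in cell h j, f t x s‖ ≤
      C * (1 + |s|) * h ^ d * |(n + 1) * τ - n * τ| := by
    refine intervalIntegral.norm_integral_le_of_norm_le_const_ae ?_
    rw [uIoc_of_le hle]
    exact (ae_restrict_iff' measurableSet_Ioc).1 h2
  have e : (n + 1) * τ - n * τ = τ := by ring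
  rw [e, abs_of_pos hτ, Real.norm_eq_abs] at h3
  have hpos : 0 < τ * h ^ d := by positivity
  rw [reactionAverage, abs_mul, abs_of_pos (by positivity), one_div, inv_mul_le_iff₀ hpos]
  linarith

end Averages

/-! ### Uniform bound on the discrete solution. -/

section MaximumPrinciple

/-- For `b < a` the sign condition gives `A (b - a) ≤ 0`; otherwise Lipschitz continuity and `A 0 =
0` suffice. The bound is proportional to the room `B - a` that is left, so a short time step cannot
pass `B`. -/
theorem RangeKernel.apply_le_mul_sub (hA : RangeKernel A) {B Λ : ℝ} (hΛ : 0 ≤ Λ)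
    (hL : ∀ a ∈ Icc (-(2 * B)) (2 * B), ∀ b ∈ Icc (-(2 * B)) (2 * B), |A a - A b| ≤ Λ * |a - b|)
    {a b : ℝ} (ha : |a| ≤ B) (hb : |b| ≤ B) : A (b - a) ≤ Λ * (B - a) := by
  have ha' := abs_le.1 ha
  have hb' := abs_le.1 hb
  rcases lt_or_ge b a with h | h
  · have h1 := hA.sign (b - a)
    have h2 : A (b - a) ≤ 0 := by
      by_contra! h3
      nlinarith
    exact h2.trans (mul_nonneg hΛ (by linarith))
  · have h1 := hL (b - a) ⟨by linarith, by linarith⟩ 0 ⟨by linarith, by linarith⟩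
    rw [hA.map_zero, sub_zero, sub_zero, abs_of_nonneg (sub_nonneg.2 h)] at h1
    refine (le_abs_self _).trans (h1.trans ?_)
    gcongr
    linarith

/-- Discrete maximum principle for one explicit step of the nonlocal diffusion. -/
theorem RangeKernel.abs_add_sum_mul_le (hA : RangeKernel A) {ι : Type*} [Fintype ι] {w v : ι → ℝ}
    {B Λ : ℝ} (hΛ : 0 ≤ Λ)
    (hL : ∀ a ∈ Icc (-(2 * B)) (2 * B), ∀ b ∈ Icc (-(2 * B)) (2 * B), |A a - A b| ≤ Λ * |a - b|)
    (hw : ∀ k, 0 ≤ w k) (hsum : Λ * ∑ k, w k ≤ 1) (hv : ∀ k, |v k| ≤ B) (j : ι) :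
    |v j + ∑ k, w k * A (v k - v j)| ≤ B := by
  -- The increment is at most `Λ (∑ w) (B - v j) ≤ B - v j`. The lower bound follows by applying
  -- this to `-v`, since `A` is odd.
  have key : ∀ (v : ι → ℝ), (∀ k, |v k| ≤ B) → v j + ∑ k, w k * A (v k - v j) ≤ B := by
    intro v hv
    have h0 : 0 ≤ B - v j := by linarith [(abs_le.1 (hv j)).2]
    have h1 : ∑ k, w k * A (v k - v j) ≤ ∑ k, w k * (Λ * (B - v j)) :=
      Finset.sum_le_sum fun k _ =>
        mul_le_mul_of_nonneg_left (hA.apply_le_mul_sub hΛ hL (hv j) (hv k)) (hw k)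
    rw [← Finset.sum_mul] at h1
    nlinarith
  rw [_root_.abs_le]
  constructor
  · have h1 := key (fun k => -v k) fun k => by rw [abs_neg]; exact hv k
    have h2 : ∀ k, A (-v k - -v j) = -A (v k - v j) := fun k => by
      rw [← hA.odd]
      congr 1
      ring
    simp only [h2, mul_neg, Finset.sum_neg_distrib] at h1
    linarith
  · exact key v hv

theorem abs_discreteOp_le {Kd B : ℝ} {v : (Fin d → Fin m) → ℝ} (hh : 0 < h)
    (hJ0 : ∀ j k : Fin d → Fin m, 0 ≤ kernelAverage h J j k)
    (hKd : ∀ j : Fin d → Fin m, h ^ d * ∑ k, kernelAverage h J j k ≤ Kd) (hB0 : 0 ≤ B)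
    {j : Fin d → Fin m} (hB : ∀ k, |A (v k - v j)| ≤ B) : |discreteOp h J A v j| ≤ Kd * B := by
  have hpos : 0 < h ^ d := by positivity
  rw [discreteOp, abs_mul, abs_of_pos hpos]
  calc h ^ d * |∑ k, kernelAverage h J j k * A (v k - v j)|
      ≤ h ^ d * ∑ k, kernelAverage h J j k * B := by
        gcongr
        refine (Finset.abs_sum_le_sum_abs _ _).trans (Finset.sum_le_sum fun k _ => ?_)
        rw [abs_mul, abs_of_nonneg (hJ0 j k)]
        exact mul_le_mul_of_nonneg_left (hB k) (hJ0 j k)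
    _ = (h ^ d * ∑ k, kernelAverage h J j k) * B := by rw [← Finset.sum_mul]; ring
    _ ≤ Kd * B := by gcongr; exact hKd j

/-- There are two regimes. If `τ Λ Kd ≤ 1`, the maximum principle handles the diffusion and the
reaction contributes exponential growth, with bound `R₁`. Otherwise the number of steps is at most
`T Λ Kd`, and a crude recursion bounds these boundedly many steps. Here `Λ` is fixed by `R₁`, which
depends on the data only. -/
theorem exists_abs_scheme_le (hT : 0 < T) (hJ : SpatialKernel L J)
    (hA : RangeKernel A) (hf : Reaction T L f) (hu₀ : InitialDatum L u₀) :
    ∃ R : ℝ, 0 < R ∧ ∀ (N m : ℕ) (τ h : ℝ), 0 < τ → 0 < h → N * τ = T → m * h = L →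
      ∀ n ≤ N, ∀ j : Fin d → Fin m, |scheme τ h J A f u₀ n j| ≤ R := by
  obtain ⟨B₀, hB₀, hu₀B⟩ := hu₀.exists_bound
  obtain ⟨Kd, hKd0, hKd⟩ := hJ.exists_sum_kernelAverage_le
  obtain ⟨Cf, hCf, hfC⟩ := hf.exists_abs_reactionAverage_le
  set R₁ := (1 + B₀) * Real.exp (Cf * T) with hR₁
  obtain ⟨Λ, hΛ, hΛL⟩ := hA.exists_lipschitz (2 * R₁)
  choose Λ' hΛ' hΛL' using fun R => hA.exists_lipschitz R
  -- A worst-case bound for one step, with the time step replaced by `T` and the local Lipschitz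
  -- constant adapted to the current bound.
  set Bs : ℕ → ℝ := fun n => Nat.rec B₀ (fun _ b =>
    b + T * (Kd * (Λ' (2 * b) * (2 * b)) + Cf * (1 + b))) n with hBs
  have hBs1 : ∀ n, Bs (n + 1) =
    Bs n + T * (Kd * (Λ' (2 * Bs n) * (2 * Bs n)) + Cf * (1 + Bs n)) := fun _ => rfl
  have hBs0 : ∀ n, 0 ≤ Bs n := by
    intro n
    induction n with
    | zero => exact hB₀
    | succ n ih =>
      rw [hBs1]
      have := (hΛ' (2 * Bs n)).le
      positivity
  have hBsm : Monotone Bs := monotone_nat_of_le_succ fun n => by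
    rw [hBs1]
    have := (hΛ' (2 * Bs n)).le
    have := hBs0 n
    have : 0 ≤ T * (Kd * (Λ' (2 * Bs n) * (2 * Bs n)) + Cf * (1 + Bs n)) := by positivity
    linarith
  set N₀ := ⌈T * (Λ * Kd)⌉₊ with hN₀
  refine ⟨max R₁ (Bs N₀), lt_max_of_lt_left (by positivity), ?_⟩
  intro N m τ h hτ hh hN hmh n hn
  have hinit : ∀ j : Fin d → Fin m, |scheme τ h J A f u₀ 0 j| ≤ B₀ := fun j =>
    abs_cellAverage_le hh (ae_cell_of_ae_cube hh hmh hu₀B j)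
  have hJ0 := hJ.kernelAverage_nonneg hh hmh
  have hsucc : ∀ n (j : Fin d → Fin m), scheme τ h J A f u₀ (n + 1) j =
      scheme τ h J A f u₀ n j + τ * (discreteOp h J A (scheme τ h J A f u₀ n) j +
        reactionAverage τ h f n j (scheme τ h J A f u₀ n j)) := fun _ _ => rfl
  by_cases hcfl : τ * (Λ * Kd) ≤ 1
  · have hbnd : ∀ n ≤ N, (1 + B₀) * (1 + τ * Cf) ^ n ≤ R₁ := by
      intro n hn
      have hnN : (n : ℝ) ≤ N := by exact_mod_cast hn
      have h1 : (1 + τ * Cf) ^ n ≤ Real.exp (Cf * T) := by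
        calc (1 + τ * Cf) ^ n ≤ Real.exp (τ * Cf) ^ n := by
              gcongr
              linarith [Real.add_one_le_exp (τ * Cf)]
          _ = Real.exp (n * (τ * Cf)) := (Real.exp_nat_mul _ _).symm
          _ ≤ Real.exp (Cf * T) := by
              refine Real.exp_le_exp.2 ?_
              rw [← hN]
              have : (n : ℝ) * (τ * Cf) ≤ N * (τ * Cf) := by gcongr
              linarith
      exact mul_le_mul_of_nonneg_left h1 (by positivity)
    -- With the shift by `1`, the step `B ↦ B + τ Cf (1 + B)` multiplies `1 + B` by exactly `1 + τ
    -- Cf`.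
    have hmain : ∀ n ≤ N, ∀ j : Fin d → Fin m,
        |scheme τ h J A f u₀ n j| ≤ (1 + B₀) * (1 + τ * Cf) ^ n - 1 := by
      intro n
      induction n with
      | zero => intro _ j; simpa using hinit j
      | succ n ih =>
        intro hn j
        have hn' : n ≤ N := by omega
        set B := (1 + B₀) * (1 + τ * Cf) ^ n - 1 with hB
        have hBR : B ≤ R₁ := by linarith [hbnd n hn']
        have hLB : ∀ a ∈ Icc (-(2 * B)) (2 * B), ∀ b ∈ Icc (-(2 * B)) (2 * B),
            |A a - A b| ≤ Λ * |a - b| := fun a ha b hb =>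
          hΛL a ⟨by linarith [ha.1], by linarith [ha.2]⟩ b ⟨by linarith [hb.1], by linarith [hb.2]⟩
        have h1 := hA.abs_add_sum_mul_le (w := fun k => τ * (h ^ d * kernelAverage h J j k))
          (v := scheme τ h J A f u₀ n) hΛ.le hLB
          (fun k => by have := hJ0 j k; positivity)
          (by
            rw [← Finset.mul_sum, ← Finset.mul_sum]
            calc Λ * (τ * (h ^ d * ∑ k, kernelAverage h J j k)) ≤ Λ * (τ * Kd) := by
                  gcongr
                  exact hKd m h hh hmh j
              _ = τ * (Λ * Kd) := by ring
              _ ≤ 1 := hcfl) (ih hn') j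
        have h2 := hfC N m τ h hτ hh hN hmh n (by omega) j (scheme τ h J A f u₀ n j)
        have h3 : |reactionAverage τ h f n j (scheme τ h J A f u₀ n j)| ≤ Cf * (1 + B) :=
          h2.trans (by gcongr; exact ih hn' j)
        have e : scheme τ h J A f u₀ (n + 1) j = (scheme τ h J A f u₀ n j +
            ∑ k, τ * (h ^ d * kernelAverage h J j k) *
              A (scheme τ h J A f u₀ n k - scheme τ h J A f u₀ n j)) +
            τ * reactionAverage τ h f n j (scheme τ h J A f u₀ n j) := by
          rw [hsucc, discreteOp, mul_add, Finset.mul_sum, Finset.mul_sum, add_assoc]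
          congr 2
          exact Finset.sum_congr rfl fun k _ => by ring
        rw [e]
        refine (abs_add_le _ _).trans ?_
        rw [abs_mul, abs_of_pos hτ]
        calc _ ≤ B + τ * (Cf * (1 + B)) := by gcongr
          _ = _ := by rw [hB, pow_succ]; ring
    intro j
    exact ((hmain n hn j).trans (by linarith [hbnd n hn])).trans (le_max_left _ _)
  · have hτT : τ ≤ T ∨ N = 0 := by
      rcases Nat.eq_zero_or_pos N with h0 | h0
      · exact Or.inr h0
      · left
        have : (1 : ℝ) ≤ N := by exact_mod_cast h0
        rw [← hN]
        nlinarith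
    -- Multiplication of `1 < τ Λ Kd` by `N` and `N τ = T` bound the number of steps.
    have hNN : N ≤ N₀ := by
      have h1 : (N : ℝ) ≤ T * (Λ * Kd) := by
        rw [← hN]
        rw [not_le] at hcfl
        have : (0 : ℝ) ≤ N := by positivity
        nlinarith
      exact_mod_cast h1.trans (Nat.le_ceil _)
    have hmain : ∀ n ≤ N, ∀ j : Fin d → Fin m, |scheme τ h J A f u₀ n j| ≤ Bs n := by
      intro n
      induction n with
      | zero => intro _ j; exact hinit j
      | succ n ih =>
        intro hn j
        have hn' : n ≤ N := by omega
        have hτT' : τ ≤ T := hτT.resolve_right (by omega)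
        have hb0 := hBs0 n
        have hΛb := (hΛ' (2 * Bs n)).le
        have h1 : |discreteOp h J A (scheme τ h J A f u₀ n) j| ≤
            Kd * (Λ' (2 * Bs n) * (2 * Bs n)) :=
          abs_discreteOp_le hh hJ0 (hKd m h hh hmh) (by positivity) fun k => by
            have g1 := _root_.abs_le.1 (ih hn' k)
            have g2 := _root_.abs_le.1 (ih hn' j)
            exact hA.abs_apply_le (by positivity) hΛb (hΛL' _) ⟨by linarith, by linarith⟩
        have h2 := hfC N m τ h hτ hh hN hmh n (by omega) j (scheme τ h J A f u₀ n j)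
        have h3 : |reactionAverage τ h f n j (scheme τ h J A f u₀ n j)| ≤ Cf * (1 + Bs n) :=
          h2.trans (by gcongr; exact ih hn' j)
        rw [hsucc, hBs1]
        refine (abs_add_le _ _).trans ?_
        rw [abs_mul, abs_of_pos hτ]
        refine add_le_add (ih hn' j) ?_
        exact mul_le_mul hτT' ((abs_add_le _ _).trans (add_le_add h1 h3)) (abs_nonneg _) hT.le
    intro j
    exact ((hmain n hn j).trans (hBsm (hn.trans hNN))).trans (le_max_right _ _)

end MaximumPrinciple

end

/-! ### Exactness of the scheme on piecewise constant functions, and projection onto them. -/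

section

variable {d m : ℕ} {T L h τ : ℝ} {J : (Fin d → ℝ) × (Fin d → ℝ) → ℝ} {A : ℝ → ℝ}
  {f : ℝ → (Fin d → ℝ) → ℝ → ℝ} {u₀ : (Fin d → ℝ) → ℝ} {u : ℝ → (Fin d → ℝ) → ℝ}

section PiecewiseConstant

/-- The function with the constant value `v j` in the cell `Ω_j`. -/
def cellwise (h : ℝ) (v : (Fin d → Fin m) → ℝ) (x : Fin d → ℝ) : ℝ :=
  ∑ j : Fin d → Fin m, (cell h j).indicator (fun _ => v j) x

theorem cellwise_of_mem (hh : 0 < h) (v : (Fin d → Fin m) → ℝ) {j : Fin d → Fin m}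
    {x : Fin d → ℝ} (hx : x ∈ cell h j) : cellwise h v x = v j := by
  rw [cellwise, Finset.sum_eq_single j]
  · exact indicator_of_mem hx _
  · intro k _ hk
    exact indicator_of_notMem (fun hx' => hk (eq_of_mem_cell hh hx' hx)) _
  · simp

theorem measurable_cellwise (h : ℝ) (v : (Fin d → Fin m) → ℝ) : Measurable (cellwise h v) :=
  Finset.measurable_fun_sum _ fun j _ => measurable_const.indicator (measurableSet_cell j)

theorem ae_cube_of_forall_mem_cell (hh : 0 < h) (hmh : m * h = L) {p : (Fin d → ℝ) → Prop}
    (hp : ∀ j : Fin d → Fin m, ∀ x ∈ cell h j, p x) :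
    ∀ᵐ x ∂(volume.restrict (cube d L)), p x := by
  subst hmh
  exact (ae_cube_iff_forall_cell hh).2 fun j =>
    (ae_restrict_iff' (measurableSet_cell j)).2 (Filter.Eventually.of_forall (hp j))

/-- The nonlocal operator on piecewise constant functions. -/
theorem nonlocalOp_cellwise (hJ : SpatialKernel L J) (hA : Continuous A) (hh : 0 < h)
    (hmh : m * h = L) (v : (Fin d → Fin m) → ℝ) (j : Fin d → Fin m) :
    ∀ᵐ x ∂(volume.restrict (cell h j)), nonlocalOp L J A (cellwise h v) x =
      ∑ k, A (v k - v j) * ∫ y in cell h k, J (x, y) := by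
  filter_upwards [ae_cell_of_ae_cube hh hmh hJ.ae_integrable j,
    ae_restrict_mem (measurableSet_cell j)] with x hx hxj
  have hint : IntegrableOn (fun y => J (x, y) * A (cellwise h v y - cellwise h v x)) (cube d L) := by
    refine integrable_mul_comp (M := ∑ k, |A (v k - v j)|) hA hx
      ((measurable_cellwise h v).sub measurable_const).aestronglyMeasurable ?_
    refine ae_cube_of_forall_mem_cell hh hmh fun k y hy => ?_
    rw [cellwise_of_mem hh v hy, cellwise_of_mem hh v hxj]
    exact Finset.single_le_sum (f := fun k => |A (v k - v j)|) (fun _ _ => abs_nonneg _)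
      (Finset.mem_univ k)
  unfold nonlocalOp
  subst hmh
  rw [integral_cube_eq_sum hh hint]
  refine Finset.sum_congr rfl fun k _ => ?_
  rw [← integral_const_mul]
  refine setIntegral_congr_fun (measurableSet_cell k) fun y hy => ?_
  rw [cellwise_of_mem hh v hy, cellwise_of_mem hh v hxj, mul_comm]

/-- On `Ω_j × Ω_k` the factor `A (v k - v j)` is constant, so only the integral of `J` over the pair
of cells enters. Averaging the kernel therefore causes no error. -/
theorem integrableOn_nonlocalOp_cellwise (hJ : SpatialKernel L J) (hA : Continuous A) (hh : 0 < h)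
    (hmh : m * h = L) (v : (Fin d → Fin m) → ℝ) (j : Fin d → Fin m) :
    IntegrableOn (nonlocalOp L J A (cellwise h v)) (cell h j) ∧
      ∫ x in cell h j, nonlocalOp L J A (cellwise h v) x = h ^ d * discreteOp h J A v j := by
  have hi : ∀ k : Fin d → Fin m, Integrable (fun x => A (v k - v j) * ∫ y in cell h k, J (x, y))
      (volume.restrict (cell h j)) := fun k =>
    (hJ.integrableOn_cell_prod hh hmh j k).integral_prod_left.const_mul _
  constructor
  · exact (integrable_finsetSum _ fun k _ => hi k).congr
      ((nonlocalOp_cellwise hJ hA hh hmh v j).mono fun x hx => hx.symm)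
  · rw [integral_congr_ae (nonlocalOp_cellwise hJ hA hh hmh v j), integral_finsetSum _ fun k _ => hi k,
      discreteOp, Finset.mul_sum, Finset.mul_sum]
    refine Finset.sum_congr rfl fun k _ => ?_
    rw [integral_const_mul, kernelAverage, two_mul, pow_add]
    field_simp

theorem Reaction.integrable_prod_cell (hf : Reaction T L f) (hτ : 0 < τ) (hh : 0 < h)
    (hmh : m * h = L) {N n : ℕ} (hN : N * τ = T) (hn : n < N) (j : Fin d → Fin m) (r : ℝ) :
    Integrable (fun z : ℝ × (Fin d → ℝ) => f z.1 z.2 r)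
      ((volume.restrict (Ioo (n * τ) ((n + 1) * τ))).prod (volume.restrict (cell h j))) := by
  rw [Measure.prod_restrict, ← Measure.volume_eq_prod]
  subst hmh
  exact (hf.bv r).1.mono_set (prod_mono (Ioo_time_subset hτ hN hn) (cell_subset_cube hh j))

theorem Reaction.integral_cell_eq (hf : Reaction T L f) (hτ : 0 < τ) (hh : 0 < h)
    (hmh : m * h = L) {N n : ℕ} (hN : N * τ = T) (hn : n < N) (j : Fin d → Fin m) (r : ℝ) :
    ∫ x in cell h j, ∫ s in Ioo (n * τ) ((n + 1) * τ), f s x r =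
      h ^ d * (τ * reactionAverage τ h f n j r) := by
  have hle : (n : ℝ) * τ ≤ (n + 1) * τ := by nlinarith
  rw [← integral_integral_swap (f := fun s x => f s x r)
    (hf.integrable_prod_cell hτ hh hmh hN hn j r), reactionAverage,
    intervalIntegral.integral_of_le hle, restrict_Ioo_eq_restrict_Ioc]
  field_simp

end PiecewiseConstant

section Projection

/-- `w x - c` is the mean of `w - c` plus the mean over `x'` of `w x - w x'`. The factor `h ^ d`
clears the denominators of these means. -/
theorem mul_lintegral_enorm_sub_le (hh : 0 < h) {w : (Fin d → ℝ) → ℝ} {j : Fin d → Fin m}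
    (hw : IntegrableOn w (cell h j)) (c : ℝ) :
    ENNReal.ofReal h ^ d * ∫⁻ x in cell h j, ‖w x - c‖ₑ ≤
      ENNReal.ofReal h ^ d * ‖∫ x in cell h j, (w x - c)‖ₑ +
        ∫⁻ x in cell h j, ∫⁻ x' in cell h j, ‖w x - w x'‖ₑ := by
  have hfin : IsFiniteMeasure (volume.restrict (cell h j)) :=
    ⟨by rw [Measure.restrict_apply_univ, volume_cell]; finiteness⟩
  have hpt : ∀ x, ENNReal.ofReal h ^ d * ‖w x - c‖ₑ ≤ ‖∫ x in cell h j, (w x - c)‖ₑ +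
      ∫⁻ x' in cell h j, ‖w x - w x'‖ₑ := by
    intro x
    have e : h ^ d * (w x - c) = (∫ x' in cell h j, (w x' - c)) + ∫ x' in cell h j, (w x - w x') := by
      have i1 : Integrable (fun x' => w x' - c) (volume.restrict (cell h j)) :=
        hw.sub (integrable_const c)
      have i2 : Integrable (fun x' => w x - w x') (volume.restrict (cell h j)) :=
        (integrable_const (w x)).sub hw
      rw [← integral_add i1 i2]
      have : ∀ x', w x' - c + (w x - w x') = w x - c := fun x' => by ring
      simp only [this]
      rw [setIntegral_const, volume_real_cell hh, smul_eq_mul]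
    have e2 : ENNReal.ofReal h ^ d * ‖w x - c‖ₑ = ‖h ^ d * (w x - c)‖ₑ := by
      rw [enorm_mul, Real.enorm_of_nonneg (pow_nonneg hh.le d), ENNReal.ofReal_pow hh.le]
    rw [e2, e]
    exact (enorm_add_le _ _).trans (add_le_add le_rfl (enorm_integral_le_lintegral_enorm _))
  rw [← lintegral_const_mul' _ _ (by finiteness)]
  refine (lintegral_mono hpt).trans ?_
  rw [lintegral_add_left measurable_const, setLIntegral_const, volume_cell, mul_comm]

end Projection

/-! ### Residual of the scheme. -/

section Consistency

/-- After exchanging the integrals, symmetry lets the marginal bound in one variable serve for the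
other, as in Schur's test. -/
theorem SpatialKernel.lintegral_mul_le (hJ : SpatialKernel L J) {K : ℝ≥0}
    (hK : ∀ᵐ x ∂(volume.restrict (cube d L)), ∫⁻ y in cube d L, ‖J (x, y)‖ₑ ≤ K)
    {g : (Fin d → ℝ) → ℝ≥0∞} (hg : AEMeasurable g (volume.restrict (cube d L))) :
    ∫⁻ x in cube d L, ∫⁻ y in cube d L, ‖J (x, y)‖ₑ * g y ≤ K * ∫⁻ y in cube d L, g y := by
  have hJm : AEMeasurable (fun p => ‖J p‖ₑ)
      ((volume.restrict (cube d L)).prod (volume.restrict (cube d L))) := by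
    have := hJ.bv.1.aestronglyMeasurable
    rw [volume_restrict_cube_prod_cube] at this
    exact this.enorm
  rw [lintegral_lintegral_swap (f := fun x y => ‖J (x, y)‖ₑ * g y) (hJm.mul hg.comp_snd),
    ← lintegral_const_mul' _ _ (by finiteness)]
  refine lintegral_mono_ae ?_
  filter_upwards [hK, hJ.ae_symm, hJ.ae_integrable] with y h1 h2 h3
  have e : (fun x => ‖J (x, y)‖ₑ * g y) =ᵐ[volume.restrict (cube d L)]
      fun x => ‖J (y, x)‖ₑ * g y := h2.mono fun x hx => by simp only [hx]
  rw [lintegral_congr_ae e, lintegral_mul_const'' _ h3.aestronglyMeasurable.enorm]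
  gcongr

theorem SpatialKernel.lintegral_mul_add_le (hJ : SpatialKernel L J) {K : ℝ≥0}
    (hK : ∀ᵐ x ∂(volume.restrict (cube d L)), ∫⁻ y in cube d L, ‖J (x, y)‖ₑ ≤ K)
    {g : (Fin d → ℝ) → ℝ≥0∞} (hg : AEMeasurable g (volume.restrict (cube d L))) :
    ∫⁻ x in cube d L, ∫⁻ y in cube d L, ‖J (x, y)‖ₑ * (g y + g x) ≤
      2 * K * ∫⁻ y in cube d L, g y := by
  calc ∫⁻ x in cube d L, ∫⁻ y in cube d L, ‖J (x, y)‖ₑ * (g y + g x)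
      ≤ ∫⁻ x in cube d L, ((∫⁻ y in cube d L, ‖J (x, y)‖ₑ * g y) + K * g x) := by
        refine lintegral_mono_ae ?_
        filter_upwards [hK, hJ.ae_integrable] with x h1 h2
        simp only [mul_add]
        have hm : AEMeasurable (fun y => ‖J (x, y)‖ₑ * g y) (volume.restrict (cube d L)) :=
          h2.aestronglyMeasurable.enorm.mul hg
        rw [lintegral_add_left' hm,
          lintegral_mul_const'' _ h2.aestronglyMeasurable.enorm]
        gcongr
    _ = (∫⁻ x in cube d L, ∫⁻ y in cube d L, ‖J (x, y)‖ₑ * g y) + K * ∫⁻ x in cube d L, g x := by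
        rw [lintegral_add_right' _ (hg.const_mul _), lintegral_const_mul'' _ hg]
    _ ≤ K * (∫⁻ x in cube d L, g x) + K * ∫⁻ x in cube d L, g x := by
        gcongr
        exact hJ.lintegral_mul_le hK hg
    _ = _ := by ring

/-- The residual of the scheme at a point, in terms of the error at the last time level. -/
theorem IsSolution.ae_enorm_residual_le (hT : 0 < T) (hJ : SpatialKernel L J)
    (hA : RangeKernel A) (hu : IsSolution T L J A f u₀ u) {R Λ Kf : ℝ} {Ku : ℝ≥0}
    (hΛ : 0 < Λ) (hΛL : ∀ a ∈ Icc (-(2 * R)) (2 * R), ∀ b ∈ Icc (-(2 * R)) (2 * R),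
      |A a - A b| ≤ Λ * |a - b|)
    (hKf : 0 ≤ Kf) (hfL : ∀ᵐ x ∂(volume.restrict (cube d L)),
      ∀ᵐ t ∂(volume.restrict (Ioo 0 T)), ∀ s ∈ Icc (-R) R, ∀ s' ∈ Icc (-R) R,
      |f t x s - f t x s'| ≤ Kf * |s - s'|)
    (hR : ∀ᵐ x ∂(volume.restrict (cube d L)), ∀ t ∈ Icc 0 T, |u t x| ≤ R)
    (hKu : ∀ᵐ x ∂(volume.restrict (cube d L)), LipschitzOnWith Ku (fun t => u t x) (Icc 0 T))
    (hh : 0 < h) (hmh : m * h = L) (hτ : 0 < τ) {N n : ℕ} (hN : N * τ = T) (hn : n < N)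
    {v : (Fin d → Fin m) → ℝ} (hv : ∀ j, |v j| ≤ R) :
    ∀ᵐ x ∂(volume.restrict (cube d L)), ∀ᵐ s ∂(volume.restrict (Ioo (n * τ) ((n + 1) * τ))),
      ‖(nonlocalOp L J A (u s) x + f s x (u s x)) -
        (nonlocalOp L J A (cellwise h v) x + f s x (cellwise h v x))‖ₑ ≤
      (∫⁻ y in cube d L, ‖J (x, y)‖ₑ *
        (ENNReal.ofReal Λ * (ENNReal.ofReal (Ku * τ) + ‖u (n * τ) y - cellwise h v y‖ₑ) +
         ENNReal.ofReal Λ * (ENNReal.ofReal (Ku * τ) + ‖u (n * τ) x - cellwise h v x‖ₑ))) +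
      ENNReal.ofReal Kf * (ENNReal.ofReal (Ku * τ) + ‖u (n * τ) x - cellwise h v x‖ₑ) := by
  have hsub := Ioo_time_subset hτ hN hn
  have hnτ : (n : ℝ) * τ ∈ Icc 0 T := by
    refine ⟨by positivity, ?_⟩
    rw [← hN]
    have : (n : ℝ) ≤ N := by exact_mod_cast hn.le
    gcongr
  have hvR : ∀ᵐ y ∂(volume.restrict (cube d L)), |cellwise h v y| ≤ R :=
    ae_cube_of_forall_mem_cell hh hmh fun j y hy => by
      rw [cellwise_of_mem hh v hy]
      exact hv j
  -- Freezing the solution at the last time level costs `Ku * τ`, so the residual bound no longer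
  -- depends on `s`.
  have hclose : ∀ s ∈ Ioo (n * τ) ((n + 1) * τ), ∀ y, LipschitzOnWith Ku (fun t => u t y) (Icc 0 T) →
      ‖u s y - cellwise h v y‖ₑ ≤
        ENNReal.ofReal (Ku * τ) + ‖u (n * τ) y - cellwise h v y‖ₑ := by
    intro s hs y hy
    have h1 := hy.dist_le_mul s (Ioo_subset_Icc_self (hsub hs)) _ hnτ
    rw [Real.dist_eq, Real.dist_eq, abs_of_pos (sub_pos.2 hs.1)] at h1
    have h2 : (Ku : ℝ) * (s - n * τ) ≤ Ku * τ := by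
      have := hs.2
      gcongr
      linarith
    have e : u s y - cellwise h v y = (u s y - u (n * τ) y) + (u (n * τ) y - cellwise h v y) := by
      ring
    rw [e]
    refine (enorm_add_le _ _).trans (add_le_add ?_ le_rfl)
    rw [Real.enorm_eq_ofReal_abs]
    exact ENNReal.ofReal_le_ofReal (h1.trans h2)
  filter_upwards [hfL, hR, hKu, hvR, hJ.ae_integrable] with x g1 g2 g3 g4 g5
  filter_upwards [ae_restrict_of_ae_restrict_of_subset hsub g1,
    ae_restrict_mem measurableSet_Ioo] with s k1 hs
  have hs' : s ∈ Icc 0 T := Ioo_subset_Icc_self (hsub hs)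
  have hus := hu.aestronglyMeasurable hT hs'
  have hxR := _root_.abs_le.1 (g2 s hs')
  have hxv := _root_.abs_le.1 g4
  have hR0 : 0 ≤ R := (abs_nonneg _).trans g4
  have m1 : ∀ᵐ y ∂(volume.restrict (cube d L)), u s y - u s x ∈ Icc (-(2 * R)) (2 * R) := by
    filter_upwards [hR] with y hy
    have := _root_.abs_le.1 (hy s hs')
    constructor <;> linarith
  have m2 : ∀ᵐ y ∂(volume.restrict (cube d L)),
      cellwise h v y - cellwise h v x ∈ Icc (-(2 * R)) (2 * R) := by
    filter_upwards [hvR] with y hy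
    have := _root_.abs_le.1 hy
    constructor <;> linarith
  rw [add_sub_add_comm]
  refine (enorm_add_le _ _).trans (add_le_add ?_ ?_)
  · have hb := enorm_integral_mul_comp_sub_le (M := Λ * (2 * R)) (Λ := Λ) hA.continuous g5 g5
      (hus.sub (aestronglyMeasurable_const (b := u s x)))
      ((measurable_cellwise h v).aestronglyMeasurable.sub
        (aestronglyMeasurable_const (b := cellwise h v x)))
      (m1.mono fun y hy => hA.abs_apply_le (by positivity) hΛ.le hΛL hy)
      (m2.mono fun y hy => hA.abs_apply_le (by positivity) hΛ.le hΛL hy)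
      (by
        filter_upwards [m1, m2] with y h1 h2
        exact hΛL _ h1 _ h2)
    simp only [sub_self, enorm_zero, lintegral_zero, mul_zero, zero_add] at hb
    refine hb.trans (lintegral_mono_ae ?_)
    filter_upwards [hKu] with y hy
    simp only [Pi.sub_apply]
    rw [← mul_add]
    gcongr
    have e : u s y - u s x - (cellwise h v y - cellwise h v x) =
        (u s y - cellwise h v y) - (u s x - cellwise h v x) := by ring
    rw [e]
    exact (enorm_sub_le).trans (add_le_add (hclose s hs y hy) (hclose s hs x g3))
  · refine le_trans ?_ (mul_le_mul_right (hclose s hs x g3) _)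
    rw [Real.enorm_eq_ofReal_abs, Real.enorm_eq_ofReal_abs, ← ENNReal.ofReal_mul hKf]
    exact ENNReal.ofReal_le_ofReal (k1 _ hxR _ hxv)

end Consistency

end

/-! ### Error recursion, convergence and uniqueness. -/

section

variable {d m : ℕ} {T L h τ : ℝ} {J : (Fin d → ℝ) × (Fin d → ℝ) → ℝ} {A : ℝ → ℝ}
  {f : ℝ → (Fin d → ℝ) → ℝ → ℝ} {u₀ : (Fin d → ℝ) → ℝ} {u : ℝ → (Fin d → ℝ) → ℝ}

/-- The `L¹(Ω)` norm of the cell averages of `w - cellwise h v`. -/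
def averageError (h : ℝ) (w : (Fin d → ℝ) → ℝ) (v : (Fin d → Fin m) → ℝ) : ℝ≥0∞ :=
  ∑ j : Fin d → Fin m, ‖∫ x in cell h j, (w x - v j)‖ₑ

theorem lintegral_enorm_sub_cellwise_eq (hh : 0 < h) (hmh : m * h = L) (w : (Fin d → ℝ) → ℝ)
    (v : (Fin d → Fin m) → ℝ) :
    ∫⁻ x in cube d L, ‖w x - cellwise h v x‖ₑ =
      ∑ j : Fin d → Fin m, ∫⁻ x in cell h j, ‖w x - v j‖ₑ := by
  subst hmh
  rw [lintegral_cube_eq_sum hh]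
  refine Finset.sum_congr rfl fun j _ => setLIntegral_congr_fun (measurableSet_cell j) fun x hx => ?_
  rw [cellwise_of_mem hh v hx]

/-- This closes the recursion: the residual involves the full `L¹` error, while the scheme
propagates only the error of the averages. -/
theorem lintegral_enorm_sub_cellwise_le (hh : 0 < h) (hmh : m * h = L) {w : (Fin d → ℝ) → ℝ}
    (hw : IntegrableOn w (cube d L)) (v : (Fin d → Fin m) → ℝ) {C : ℝ≥0∞}
    (hC : ∑ j : Fin d → Fin m, ∫⁻ x in cell h j, ∫⁻ x' in cell h j, ‖w x - w x'‖ₑ ≤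
        C * ENNReal.ofReal h * ENNReal.ofReal h ^ d) :
    ∫⁻ x in cube d L, ‖w x - cellwise h v x‖ₑ ≤ averageError h w v + C * ENNReal.ofReal h := by
  have hpos : ENNReal.ofReal h ^ d ≠ 0 := pow_ne_zero _ (by simpa using hh)
  have hfin : ENNReal.ofReal h ^ d ≠ ∞ := by finiteness
  rw [← ENNReal.mul_le_mul_iff_right hpos hfin, lintegral_enorm_sub_cellwise_eq hh hmh,
    Finset.mul_sum]
  have hw' : ∀ j : Fin d → Fin m, IntegrableOn w (cell h j) := fun j =>
    hw.mono_set (hmh ▸ cell_subset_cube hh j)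
  refine (Finset.sum_le_sum fun j _ => mul_lintegral_enorm_sub_le hh (hw' j) (v j)).trans ?_
  rw [Finset.sum_add_distrib, ← Finset.mul_sum, mul_add]
  refine add_le_add le_rfl (hC.trans (le_of_eq (mul_comm _ _)))

theorem integrableOn_of_ae_bound {w : (Fin d → ℝ) → ℝ} {R : ℝ}
    (hw : AEStronglyMeasurable w (volume.restrict (cube d L)))
    (hR : ∀ᵐ x ∂(volume.restrict (cube d L)), |w x| ≤ R) : IntegrableOn w (cube d L) :=
  (integrable_const R).mono' hw hR

/-- One step of the error recursion. -/
theorem IsSolution.averageError_succ_le (hT : 0 < T) (hJ : SpatialKernel L J)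
    (hA : RangeKernel A) (hf : Reaction T L f)
    (hu : IsSolution T L J A f u₀ u) {R Λ Kf : ℝ} {Ku KJ : ℝ≥0}
    (hΛ : 0 < Λ) (hΛL : ∀ a ∈ Icc (-(2 * R)) (2 * R), ∀ b ∈ Icc (-(2 * R)) (2 * R),
      |A a - A b| ≤ Λ * |a - b|)
    (hKf : 0 ≤ Kf) (hfL : ∀ᵐ x ∂(volume.restrict (cube d L)),
      ∀ᵐ t ∂(volume.restrict (Ioo 0 T)), ∀ s ∈ Icc (-R) R, ∀ s' ∈ Icc (-R) R,
      |f t x s - f t x s'| ≤ Kf * |s - s'|)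
    (hR : ∀ᵐ x ∂(volume.restrict (cube d L)), ∀ t ∈ Icc 0 T, |u t x| ≤ R)
    (hKu : ∀ᵐ x ∂(volume.restrict (cube d L)), LipschitzOnWith Ku (fun t => u t x) (Icc 0 T))
    (hKJ : ∀ᵐ x ∂(volume.restrict (cube d L)), ∫⁻ y in cube d L, ‖J (x, y)‖ₑ ≤ KJ)
    (hh : 0 < h) (hmh : m * h = L) (hτ : 0 < τ) {N n : ℕ} (hN : N * τ = T) (hn : n < N)
    (hv : ∀ j : Fin d → Fin m, |scheme τ h J A f u₀ n j| ≤ R) :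
    averageError (m := m) h (u ((n + 1 : ℕ) * τ)) (scheme τ h J A f u₀ (n + 1)) ≤
      averageError (m := m) h (u (n * τ)) (scheme τ h J A f u₀ n) + ENNReal.ofReal τ *
        ((2 * KJ * ENNReal.ofReal Λ + ENNReal.ofReal Kf) *
          (ENNReal.ofReal (Ku * τ) * volume (cube d L) +
            ∫⁻ x in cube d L, ‖u (n * τ) x - cellwise (m := m) h (scheme τ h J A f u₀ n) x‖ₑ)) := by
  set v := scheme (m := m) τ h J A f u₀ n with hvdef
  have hn1 : ((n + 1 : ℕ) : ℝ) * τ = (n + 1) * τ := by push_cast; ring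
  rw [hn1]
  have hnN : (n : ℝ) + 1 ≤ N := by exact_mod_cast hn
  have hle : (n : ℝ) * τ ≤ (n + 1) * τ := by nlinarith
  have ht0 : (0 : ℝ) ≤ n * τ := by positivity
  have ht1 : ((n : ℝ) + 1) * τ ≤ T := by rw [← hN]; gcongr
  have hmem0 : (n : ℝ) * τ ∈ Icc 0 T := ⟨ht0, hle.trans ht1⟩
  have hmem1 : ((n : ℝ) + 1) * τ ∈ Icc 0 T := ⟨ht0.trans hle, ht1⟩
  have hui : ∀ t ∈ Icc 0 T, ∀ j : Fin d → Fin m, IntegrableOn (u t) (cell h j) := fun t ht j =>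
    (integrableOn_of_ae_bound (hu.aestronglyMeasurable hT ht)
      (hR.mono fun x hx => hx t ht)).mono_set (hmh ▸ cell_subset_cube hh j)
  set κ := ENNReal.ofReal (Ku * τ) with hκ
  set e : (Fin d → ℝ) → ℝ≥0∞ := fun x => ‖u (n * τ) x - cellwise h v x‖ₑ with he
  set g : (Fin d → ℝ) → ℝ≥0∞ := fun x => ENNReal.ofReal Λ * (κ + e x) with hg
  set β : (Fin d → ℝ) → ℝ≥0∞ := fun x =>
    (∫⁻ y in cube d L, ‖J (x, y)‖ₑ * (g y + g x)) + ENNReal.ofReal Kf * (κ + e x) with hβ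
  have hem : AEMeasurable e (volume.restrict (cube d L)) :=
    ((hu.aestronglyMeasurable hT hmem0).sub (measurable_cellwise h v).aestronglyMeasurable).enorm
  have hres := hu.ae_enorm_residual_le hT hJ hA hΛ hΛL hKf hfL hR hKu hh hmh hτ hN hn hv
  -- the increment of the error in a cell is the integral of the residual
  have hcell : ∀ j : Fin d → Fin m, ‖∫ x in cell h j, (u ((n + 1) * τ) x -
      scheme τ h J A f u₀ (n + 1) j)‖ₑ ≤ ‖∫ x in cell h j, (u (n * τ) x - v j)‖ₑ +
        ∫⁻ x in cell h j, ENNReal.ofReal τ * β x := by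
    intro j
    have hcfin : IsFiniteMeasure (volume.restrict (cell h j)) :=
      ⟨by rw [Measure.restrict_apply_univ, volume_cell]; finiteness⟩
    obtain ⟨i1, v1⟩ := integrableOn_nonlocalOp_cellwise hJ hA.continuous hh hmh v j
    have i2 := (hf.integrable_prod_cell hτ hh hmh hN hn j (v j)).integral_prod_right
    have v2 := hf.integral_cell_eq hτ hh hmh hN hn j (v j)
    have iu1 := hui _ hmem1 j
    have iu0 := hui _ hmem0 j
    -- One step of the scheme is rewritten as the cell integral of the undiscretised right-hand side
    -- at `cellwise h v`, integrated over the time step.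
    have hsplit : ∫ x in cell h j, (u ((n + 1) * τ) x - scheme τ h J A f u₀ (n + 1) j) =
        (∫ x in cell h j, (u (n * τ) x - v j)) + ∫ x in cell h j, ((u ((n + 1) * τ) x - u (n * τ) x) -
          (τ * nonlocalOp L J A (cellwise h v) x +
            ∫ s in Ioo (n * τ) ((n + 1) * τ), f s x (v j))) := by
      have hs : scheme τ h J A f u₀ (n + 1) j =
        v j + τ * (discreteOp h J A v j + reactionAverage τ h f n j (v j)) := rfl
      have i3 : Integrable (fun x => u ((n + 1) * τ) x - u (n * τ) x)
        (volume.restrict (cell h j)) := iu1.sub iu0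
      have i4 : Integrable (fun x => τ * nonlocalOp L J A (cellwise h v) x +
          ∫ s in Ioo (n * τ) ((n + 1) * τ), f s x (v j)) (volume.restrict (cell h j)) :=
        (i1.const_mul τ).add i2
      rw [integral_sub iu1 (integrable_const _), integral_sub iu0 (integrable_const _),
        integral_sub i3 i4, integral_sub iu1 iu0,
        integral_add (i1.const_mul τ) i2, integral_const_mul, v1, v2, setIntegral_const,
        setIntegral_const, volume_real_cell hh, hs]
      simp only [smul_eq_mul]
      ring
    rw [hsplit]
    refine (enorm_add_le _ _).trans (add_le_add le_rfl ?_)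
    refine (enorm_integral_le_lintegral_enorm _).trans (lintegral_mono_ae ?_)
    have hslice : ∀ᵐ x ∂(volume.restrict (cube d L)),
        IntegrableOn (fun s => f s x (v j)) (Ioo 0 T) :=
      ae_integrable_slice_of_cylinder (hf.bv (v j)).1
    filter_upwards [ae_cell_of_ae_cube hh hmh hres j, ae_cell_of_ae_cube hh hmh hKu j,
      ae_cell_of_ae_cube hh hmh hu.equation j, ae_cell_of_ae_cube hh hmh hslice j,
      ae_restrict_mem (measurableSet_cell j)] with x a1 a2 a3 a4 a5
    obtain ⟨c1, c2⟩ := intervalIntegrable_and_integral_eq_sub a2 a3 ht0 hle ht1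
    have c3 : IntegrableOn (fun s => nonlocalOp L J A (u s) x + f s x (u s x))
        (Ioo (n * τ) ((n + 1) * τ)) := c1.1.mono_set Ioo_subset_Ioc_self
    have c4 : IntegrableOn (fun s => f s x (v j)) (Ioo (n * τ) ((n + 1) * τ)) :=
      a4.mono_set (Ioo_time_subset hτ hN hn)
    have hvol : volume.real (Ioo ((n : ℝ) * τ) ((n + 1) * τ)) = τ := by
      rw [Real.volume_real_Ioo_of_le hle]
      ring
    have hce : cellwise h v x = v j := cellwise_of_mem hh v a5
    have c5 : (u ((n + 1) * τ) x - u (n * τ) x) - (τ * nonlocalOp L J A (cellwise h v) x +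
            ∫ s in Ioo (n * τ) ((n + 1) * τ), f s x (v j)) =
        ∫ s in Ioo (n * τ) ((n + 1) * τ), ((nonlocalOp L J A (u s) x + f s x (u s x)) -
          (nonlocalOp L J A (cellwise h v) x + f s x (cellwise h v x))) := by
      have c6 : Integrable (fun s => nonlocalOp L J A (cellwise h v) x + f s x (v j))
          (volume.restrict (Ioo (n * τ) ((n + 1) * τ))) := (integrable_const _).add c4
      rw [hce, integral_sub c3 c6, integral_add (integrable_const _) c4,
        setIntegral_const, hvol, smul_eq_mul, ← c2, intervalIntegral.integral_of_le hle,
        restrict_Ioo_eq_restrict_Ioc]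
    rw [c5]
    -- The residual bound is constant in time, so integrating it over the step gives the factor `τ`.
    refine (enorm_integral_le_lintegral_enorm _).trans ((lintegral_mono_ae a1).trans ?_)
    rw [setLIntegral_const, Real.volume_Ioo]
    have : ((n : ℝ) + 1) * τ - n * τ = τ := by ring
    rw [this, mul_comm]
  have hβint : ∫⁻ x in cube d L, β x ≤ (2 * KJ * ENNReal.ofReal Λ + ENNReal.ofReal Kf) *
      (κ * volume (cube d L) + ∫⁻ x in cube d L, e x) := by
    have hke : ∫⁻ x in cube d L, (κ + e x) = κ * volume (cube d L) + ∫⁻ x in cube d L, e x := by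
      rw [lintegral_add_left measurable_const, setLIntegral_const]
    have hkm : AEMeasurable (fun x => κ + e x) (volume.restrict (cube d L)) := hem.const_add κ
    rw [hβ, lintegral_add_right' _ (hkm.const_mul _), lintegral_const_mul'' _ hkm]
    refine (add_le_add (hJ.lintegral_mul_add_le hKJ (hkm.const_mul _)) le_rfl).trans ?_
    rw [lintegral_const_mul'' _ hkm, hke]
    apply le_of_eq
    ring
  calc averageError h (u ((n + 1) * τ)) (scheme τ h J A f u₀ (n + 1))
      ≤ ∑ j : Fin d → Fin m, (‖∫ x in cell h j, (u (n * τ) x - v j)‖ₑ +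
        ∫⁻ x in cell h j, ENNReal.ofReal τ * β x) := Finset.sum_le_sum fun j _ => hcell j
    _ = averageError h (u (n * τ)) v + ∫⁻ x in cube d L, ENNReal.ofReal τ * β x := by
        rw [Finset.sum_add_distrib, ← hmh, lintegral_cube_eq_sum hh]
        rfl
    _ = averageError h (u (n * τ)) v + ENNReal.ofReal τ * ∫⁻ x in cube d L, β x := by
        rw [lintegral_const_mul' _ _ ENNReal.ofReal_ne_top]
    _ ≤ _ := by gcongr

theorem IsSolution.averageError_zero (hu : IsSolution T L J A f u₀ u)
    (hu₀ : InitialDatum L u₀) (hh : 0 < h) (hmh : m * h = L) :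
    averageError (m := m) h (u 0) (scheme τ h J A f u₀ 0) = 0 := by
  refine Finset.sum_eq_zero fun j _ => ?_
  have hcfin : IsFiniteMeasure (volume.restrict (cell h j)) :=
    ⟨by rw [Measure.restrict_apply_univ, volume_cell]; finiteness⟩
  have hi : IntegrableOn u₀ (cell h j) := hu₀.bv.1.mono_set (hmh ▸ cell_subset_cube hh j)
  have e : ∫ x in cell h j, (u 0 x - scheme τ h J A f u₀ 0 j) =
      ∫ x in cell h j, (u₀ x - cellAverage h u₀ j) := by
    refine integral_congr_ae ?_
    filter_upwards [ae_cell_of_ae_cube hh hmh hu.initial j] with x hx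
    rw [hx]
    rfl
  have hpos : h ^ d ≠ 0 := by positivity
  rw [e, integral_sub hi (integrable_const _), setIntegral_const, volume_real_cell hh, cellAverage,
    smul_eq_mul]
  field_simp
  simp

/-- Discrete Gronwall inequality. -/
theorem add_le_exp_mul_of_forall_succ_le {E : ℕ → ℝ≥0∞} {q : ℝ≥0∞} {c τ T : ℝ} {N : ℕ}
    (hc : 0 ≤ c) (hτ : 0 ≤ τ) (hN : N * τ = T) (h0 : E 0 = 0)
    (hE : ∀ n < N, E (n + 1) ≤ E n + ENNReal.ofReal τ * (ENNReal.ofReal c * (E n + q)))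
    {n : ℕ} (hn : n ≤ N) : E n + q ≤ ENNReal.ofReal (Real.exp (c * T)) * q := by
  have h1 : ∀ n ≤ N, E n + q ≤ ENNReal.ofReal (Real.exp (c * (n * τ))) * q := by
    intro n
    induction n with
    | zero => intro _; simp [h0]
    | succ n ih =>
      intro hn
      -- Adding `q` makes the recursion homogeneous: `E n + q` grows by at most the factor `1 + τ c
      -- ≤ exp (c τ)`.
      have h2 : (1 : ℝ≥0∞) + ENNReal.ofReal τ * ENNReal.ofReal c ≤
          ENNReal.ofReal (Real.exp (c * τ)) := by
        rw [← ENNReal.ofReal_mul hτ, ← ENNReal.ofReal_one, ← ENNReal.ofReal_add zero_le_one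
          (by positivity)]
        exact ENNReal.ofReal_le_ofReal (by linarith [Real.add_one_le_exp (c * τ)])
      calc E (n + 1) + q ≤ E n + ENNReal.ofReal τ * (ENNReal.ofReal c * (E n + q)) + q := by
            gcongr
            exact hE n (by omega)
        _ = (1 + ENNReal.ofReal τ * ENNReal.ofReal c) * (E n + q) := by ring
        _ ≤ ENNReal.ofReal (Real.exp (c * τ)) *
            (ENNReal.ofReal (Real.exp (c * (n * τ))) * q) := by
            gcongr
            exact ih (by omega)
        _ = ENNReal.ofReal (Real.exp (c * ((n + 1 : ℕ) * τ))) * q := by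
            rw [← mul_assoc, ← ENNReal.ofReal_mul (Real.exp_pos _).le, ← Real.exp_add]
            congr 3
            push_cast
            ring
  refine (h1 n hn).trans ?_
  gcongr
  rw [← hN]
  have : (n : ℝ) ≤ N := by exact_mod_cast hn
  gcongr

theorem discreteSolution_eq {N : ℕ} (hT : 0 < T) (hh : 0 < L / m) {n : ℕ} (hn : n < N)
    {t : ℝ} (ht : t ∈ Ico (n * (T / N)) ((n + 1) * (T / N))) {j : Fin d → Fin m} {x : Fin d → ℝ}
    (hx : x ∈ cell (L / m) j) :
    discreteSolution T L J A f u₀ N m t x = scheme (T / N) (L / m) J A f u₀ n j := by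
  have hNpos : (0 : ℝ) < N := by exact_mod_cast (Nat.zero_le n).trans_lt hn
  have hτ : 0 < T / N := by positivity
  rw [discreteSolution, Finset.sum_eq_single n, Finset.sum_eq_single j]
  · rw [if_pos ⟨ht, hx⟩]
  · intro k _ hk
    exact if_neg fun h => hk (eq_of_mem_cell hh h.2 hx)
  · simp
  · intro k _ hk
    refine Finset.sum_eq_zero fun i _ => if_neg fun h => hk ?_
    have a1 : (k : ℝ) < (n : ℝ) + 1 := lt_of_mul_lt_mul_right (h.1.1.trans_lt ht.2) hτ.le
    have a2 : (n : ℝ) < (k : ℝ) + 1 := lt_of_mul_lt_mul_right (ht.1.trans_lt h.1.2) hτ.le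
    have b1 : k < n + 1 := by exact_mod_cast a1
    have b2 : n < k + 1 := by exact_mod_cast a2
    omega
  · exact fun h => absurd (Finset.mem_range.2 hn) h

/-- The error estimate, with a constant that is allowed to depend on the solution. Combined with
uniqueness of the solution, this gives a constant that depends on the data only. -/
theorem IsSolution.exists_error_le (hT : 0 < T) (hL : 0 < L) (hJ : SpatialKernel L J)
    (hA : RangeKernel A) (hf : Reaction T L f) (hu₀ : InitialDatum L u₀)
    (hu : IsSolution T L J A f u₀ u) :
    ∃ C : ℝ≥0, ∀ N m : ℕ, 1 ≤ N → 1 ≤ m → ∀ t ∈ Ioo 0 T,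
      ∫⁻ x in cube d L, ‖u t x - discreteSolution T L J A f u₀ N m t x‖ₑ ≤
        C * ENNReal.ofReal (T / N + L / m) := by
  obtain ⟨Ru, hRu, hRux⟩ := hu.exists_bound hT hu₀
  obtain ⟨Rs, hRs, hRsx⟩ := exists_abs_scheme_le hT hJ hA hf hu₀
  set R := max Ru Rs with hR
  obtain ⟨Λ, hΛ, hΛL⟩ := hA.exists_lipschitz (2 * R)
  obtain ⟨Kf, hKf, hfL⟩ := hf.exists_lipschitz R
  obtain ⟨Ku, hKu⟩ := hu.lipschitz
  obtain ⟨KJ, hKJ⟩ := hJ.marginal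
  obtain ⟨Co, hCo, hosc⟩ := hu.exists_oscillation_le hT hL hJ hA hf hu₀
  have hRux' : ∀ᵐ x ∂(volume.restrict (cube d L)), ∀ t ∈ Icc 0 T, |u t x| ≤ R :=
    hRux.mono fun x hx t ht => (hx t ht).trans (le_max_left _ _)
  have hV : volume (cube d L) ≠ ∞ := by rw [volume_cube]; finiteness
  set c : ℝ := 2 * KJ * Λ + Kf with hc
  have hc0 : 0 ≤ c := by positivity
  have hcE : ENNReal.ofReal c = 2 * KJ * ENNReal.ofReal Λ + ENNReal.ofReal Kf := by
    rw [hc, ENNReal.ofReal_add (by positivity) hKf, ENNReal.ofReal_mul (by positivity),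
      ENNReal.ofReal_mul (by norm_num)]
    simp
  set C : ℝ≥0∞ := ENNReal.ofReal (Real.exp (c * T)) * (Ku * volume (cube d L) + Co) with hC
  have hCfin : C ≠ ∞ := by finiteness
  refine ⟨C.toNNReal, fun N m hN1 hm1 t ht => ?_⟩
  rw [ENNReal.coe_toNNReal hCfin]
  have hNpos : (0 : ℝ) < N := by exact_mod_cast hN1
  have hmpos : (0 : ℝ) < m := by exact_mod_cast hm1
  set τ := T / N with hτdef
  set h := L / m with hhdef
  have hτ : 0 < τ := by positivity
  have hh : 0 < h := by positivity
  have hN : N * τ = T := by rw [hτdef]; field_simp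
  have hmh : m * h = L := by rw [hhdef]; field_simp
  set κ := ENNReal.ofReal (Ku * τ) with hκ
  -- `q` collects the forcing of the recursion: the time-freezing error, of order `τ`, and the cell
  -- oscillation, of order `h`.
  set q : ℝ≥0∞ := κ * volume (cube d L) + Co * ENNReal.ofReal h with hq
  set v : ℕ → (Fin d → Fin m) → ℝ := scheme τ h J A f u₀ with hv
  set E : ℕ → ℝ≥0∞ := fun n => averageError h (u (n * τ)) (v n) with hE
  have htime : ∀ n ≤ N, (n : ℝ) * τ ∈ Icc 0 T := fun n hn => by
    refine ⟨by positivity, ?_⟩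
    rw [← hN]
    have : (n : ℝ) ≤ N := by exact_mod_cast hn
    gcongr
  have hproj : ∀ n ≤ N, κ * volume (cube d L) +
      ∫⁻ x in cube d L, ‖u (n * τ) x - cellwise h (v n) x‖ₑ ≤ E n + q := by
    intro n hn
    have h1 := lintegral_enorm_sub_cellwise_le hh hmh (integrableOn_of_ae_bound
      (hu.aestronglyMeasurable hT (htime n hn)) (hRux.mono fun x hx => hx _ (htime n hn))) (v n)
      (hosc m h hh hmh _ (htime n hn))
    calc _ ≤ κ * volume (cube d L) + (averageError h (u (n * τ)) (v n) + Co * ENNReal.ofReal h) := by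
          gcongr
      _ = E n + q := by rw [hq, hE]; ring
  have hrec : ∀ n ≤ N, E n + q ≤ ENNReal.ofReal (Real.exp (c * T)) * q := by
    intro n hn
    refine add_le_exp_mul_of_forall_succ_le hc0 hτ.le hN ?_ (fun n hn => ?_) hn
    · simpa [hE] using hu.averageError_zero hu₀ hh hmh
    · have h1 := hu.averageError_succ_le hT hJ hA hf hΛ hΛL hKf hfL hRux' hKu hKJ hh hmh hτ hN hn
        fun j => (hRsx N m τ h hτ hh hN hmh n hn.le j).trans (le_max_right _ _)
      refine h1.trans ?_
      rw [hcE]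
      exact add_le_add le_rfl (mul_le_mul_right (mul_le_mul_right (hproj n hn.le) _) _)
  -- Between time levels the interpolator is constant and `u` moves by at most `Ku * τ`, a cost
  -- already contained in the quantity bounded by `hproj`.
  obtain ⟨n, hn, htn⟩ : ∃ n < N, t ∈ Ico (n * τ) ((n + 1) * τ) := by
    have h0 : 0 ≤ t / τ := div_nonneg ht.1.le hτ.le
    refine ⟨⌊t / τ⌋₊, ?_, ?_, ?_⟩
    · rw [Nat.floor_lt h0, div_lt_iff₀ hτ, hN]
      exact ht.2
    · exact (le_div_iff₀ hτ).1 (Nat.floor_le h0)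
    · exact (div_lt_iff₀ hτ).1 (Nat.lt_floor_add_one _)
  have hdisc : ∀ᵐ x ∂(volume.restrict (cube d L)),
      discreteSolution T L J A f u₀ N m t x = cellwise h (v n) x :=
    ae_cube_of_forall_mem_cell hh hmh fun j x hx => by
      rw [cellwise_of_mem hh (v n) hx]
      exact discreteSolution_eq hT hh hn htn hx
  calc ∫⁻ x in cube d L, ‖u t x - discreteSolution T L J A f u₀ N m t x‖ₑ
      ≤ ∫⁻ x in cube d L, (κ + ‖u (n * τ) x - cellwise h (v n) x‖ₑ) := by
        refine lintegral_mono_ae ?_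
        filter_upwards [hdisc, hKu] with x h1 h2
        rw [h1]
        have h3 := h2.dist_le_mul t (Ioo_subset_Icc_self ht) _ (htime n hn.le)
        rw [Real.dist_eq, Real.dist_eq, abs_of_nonneg (sub_nonneg.2 htn.1)] at h3
        have h4 : (Ku : ℝ) * (t - n * τ) ≤ Ku * τ := by
          have := htn.2
          gcongr
          linarith
        have e : u t x - cellwise h (v n) x =
            (u t x - u (n * τ) x) + (u (n * τ) x - cellwise h (v n) x) := by ring
        rw [e]
        refine (enorm_add_le _ _).trans (add_le_add ?_ le_rfl)
        rw [Real.enorm_eq_ofReal_abs]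
        exact ENNReal.ofReal_le_ofReal (h3.trans h4)
    _ = κ * volume (cube d L) + ∫⁻ x in cube d L, ‖u (n * τ) x - cellwise h (v n) x‖ₑ := by
        rw [lintegral_add_left measurable_const, setLIntegral_const]
    _ ≤ E n + q := hproj n hn.le
    _ ≤ ENNReal.ofReal (Real.exp (c * T)) * q := hrec n hn.le
    _ ≤ C * ENNReal.ofReal (τ + h) := by
        rw [hC, mul_assoc]
        gcongr
        have e1 : κ = Ku * ENNReal.ofReal τ := by
          rw [hκ, ENNReal.ofReal_mul (NNReal.coe_nonneg Ku), ENNReal.ofReal_coe_nnreal]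
        rw [hq, e1, ENNReal.ofReal_add hτ.le hh.le]
        calc (Ku : ℝ≥0∞) * ENNReal.ofReal τ * volume (cube d L) + Co * ENNReal.ofReal h
            = Ku * volume (cube d L) * ENNReal.ofReal τ + Co * ENNReal.ofReal h := by ring
          _ ≤ Ku * volume (cube d L) * (ENNReal.ofReal τ + ENNReal.ofReal h) +
              Co * (ENNReal.ofReal τ + ENNReal.ofReal h) := by
              gcongr
              · exact le_self_add
              · exact le_add_self
          _ = _ := by ring

theorem measurable_discreteSolution {N : ℕ} (t : ℝ) :
    Measurable (discreteSolution T L J A f u₀ N m t) := by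
  refine Finset.measurable_fun_sum _ fun n _ => Finset.measurable_fun_sum _ fun j _ => ?_
  refine Measurable.ite ?_ measurable_const measurable_const
  by_cases ht : t ∈ Ico (n * (T / N)) ((n + 1) * (T / N))
  · simpa [ht] using measurableSet_cell j
  · simp [ht]

/-- Solutions are unique, being limits of the scheme. -/
theorem IsSolution.ae_eq (hT : 0 < T) (hL : 0 < L) (hJ : SpatialKernel L J)
    (hA : RangeKernel A) (hf : Reaction T L f) (hu₀ : InitialDatum L u₀)
    (hu : IsSolution T L J A f u₀ u) {w : ℝ → (Fin d → ℝ) → ℝ} (hw : IsSolution T L J A f u₀ w)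
    {t : ℝ} (ht : t ∈ Ioo 0 T) : u t =ᵐ[volume.restrict (cube d L)] w t := by
  obtain ⟨C, hC⟩ := hu.exists_error_le hT hL hJ hA hf hu₀
  obtain ⟨C', hC'⟩ := hw.exists_error_le hT hL hJ hA hf hu₀
  -- Both solutions are compared with the same discrete solution for `N = m = k + 1`, which depends
  -- on the data only.
  have hk : ∀ k : ℕ, ∫⁻ x in cube d L, ‖u t x - w t x‖ₑ ≤
      (C + C') * ENNReal.ofReal ((T + L) * (1 / ((k : ℝ) + 1))) := by
    intro k
    have h1 := hC (k + 1) (k + 1) (by omega) (by omega) t ht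
    have h2 := hC' (k + 1) (k + 1) (by omega) (by omega) t ht
    set D := discreteSolution T L J A f u₀ (k + 1) (k + 1) t with hD
    have hDm : Measurable D := measurable_discreteSolution t
    have hum := hu.aestronglyMeasurable hT (Ioo_subset_Icc_self ht)
    have e : T / ((k + 1 : ℕ) : ℝ) + L / ((k + 1 : ℕ) : ℝ) = (T + L) * (1 / ((k : ℝ) + 1)) := by
      push_cast
      ring
    rw [e] at h1 h2
    calc ∫⁻ x in cube d L, ‖u t x - w t x‖ₑ
        ≤ ∫⁻ x in cube d L, (‖u t x - D x‖ₑ + ‖w t x - D x‖ₑ) := by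
          refine lintegral_mono fun x => ?_
          have : u t x - w t x = (u t x - D x) - (w t x - D x) := by ring
          rw [this]
          exact enorm_sub_le
      _ = (∫⁻ x in cube d L, ‖u t x - D x‖ₑ) + ∫⁻ x in cube d L, ‖w t x - D x‖ₑ :=
          lintegral_add_left' (hum.sub hDm.aestronglyMeasurable).enorm _
      _ ≤ _ := by
          rw [add_mul]
          exact add_le_add h1 h2
  have hlim : Filter.Tendsto (fun k : ℕ => ((C : ℝ≥0∞) + C') *
      ENNReal.ofReal ((T + L) * (1 / ((k : ℝ) + 1)))) Filter.atTop (nhds 0) := by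
    have h1 : Filter.Tendsto (fun k : ℕ => ENNReal.ofReal ((T + L) * (1 / ((k : ℝ) + 1))))
        Filter.atTop (nhds 0) := by
      have := ENNReal.tendsto_ofReal
        ((tendsto_one_div_add_atTop_nhds_zero_nat (𝕜 := ℝ)).const_mul (T + L))
      simpa using this
    have h2 := ENNReal.Tendsto.const_mul (a := (C : ℝ≥0∞) + C') h1
      (Or.inr (by finiteness))
    simpa using h2
  have h0 : ∫⁻ x in cube d L, ‖u t x - w t x‖ₑ = 0 :=
    le_antisymm (ge_of_tendsto' hlim hk) zero_le
  have hmeas : AEMeasurable (fun x => ‖u t x - w t x‖ₑ) (volume.restrict (cube d L)) :=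
    ((hu.aestronglyMeasurable hT (Ioo_subset_Icc_self ht)).sub
      (hw.aestronglyMeasurable hT (Ioo_subset_Icc_self ht))).enorm
  rw [lintegral_eq_zero_iff' hmeas] at h0
  filter_upwards [h0] with x hx
  simpa [sub_eq_zero] using hx

end

end NonlocalDiffusion

end

theorem mainTheorem1 (d : ℕ) (hd : 1 ≤ d) (T L : ℝ) (hT : 0 < T) (hL : 0 < L)
    (J : (Fin d → ℝ) × (Fin d → ℝ) → ℝ) (A : ℝ → ℝ)
    (f : ℝ → (Fin d → ℝ) → ℝ → ℝ) (u₀ : (Fin d → ℝ) → ℝ)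
    (hJ : NonlocalDiffusion.SpatialKernel L J)
    (hA : NonlocalDiffusion.RangeKernel A)
    (hf : NonlocalDiffusion.Reaction T L f)
    (hu₀ : NonlocalDiffusion.InitialDatum L u₀) :
    ∃ C : ℝ, ∀ u : ℝ → (Fin d → ℝ) → ℝ,
      NonlocalDiffusion.IsSolution T L J A f u₀ u →
      ∀ N m : ℕ, 1 ≤ N → 1 ≤ m → T / N < 1 → L / m < 1 →
        NonlocalDiffusion.normLinftyL1 T L
            (fun t x => u t x - NonlocalDiffusion.discreteSolution T L J A f u₀ N m t x) ≤
          ENNReal.ofReal (C * (T / N + L / m)) := by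
  -- The constant has to precede the solution. It is taken from one solution `w` and transferred to
  -- the others by uniqueness; if there is no solution, any constant will do.
  by_cases hex : ∃ w, NonlocalDiffusion.IsSolution T L J A f u₀ w
  · obtain ⟨w, hw⟩ := hex
    obtain ⟨C, hC⟩ := hw.exists_error_le hT hL hJ hA hf hu₀
    refine ⟨C, fun u hu N m hN hm _ _ => essSup_le_of_ae_le _ ?_⟩
    filter_upwards [ae_restrict_mem measurableSet_Ioo] with t ht
    rw [ENNReal.ofReal_mul (NNReal.coe_nonneg C), ENNReal.ofReal_coe_nnreal]
    refine le_trans (le_of_eq ?_) (hC N m hN hm t ht)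
    refine lintegral_congr_ae ?_
    filter_upwards [hu.ae_eq hT hL hJ hA hf hu₀ hw ht] with x hx
    rw [hx]
  · exact ⟨0, fun u hu => absurd ⟨u, hu⟩ hex⟩
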